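/- Let $A$ be a noetherian commutative ring, let $n \ge 0$, and let $f(u)=\sum_{i=0}^n a_{2n-2i}u^{2i}$ be a monic polynomial in $u^2$ with coefficients in $A$ (so $a_0=1$). Let $B = A[\eta_1,\dots,\eta_n]/I$ be the \emph{signed splitting ring} of $f$, where $I$ is the ideal generated by the coefficients (in $u$) of $f(u)-\prod_{i=1}^n(u^2-\eta_i^2)$. Put $\tilde f(v)=\sum_{i=0}^n a_{2n-2i}v^i$, so that $\tilde f(u^2)=f(u)$, and let $\Delta=(-4)^n a_{2n}\operatorname{disc}(\tilde f)\in A$; in $B$ one has $\Delta = 4^n\,\eta_1^2\cdots\eta_n^2\prod_{i<j}(\eta_i^2-\eta_j^2)^2$. A ring is \emph{normal} if its localizations at all prime ideals are integrally closed domains. An element $x$ of a normal noetherian ring $R$ is \emph{squarefree} if $v_{\mathfrak p}(x)\in\{0,1\}$ for every height one prime $\mathfrak p$ of $R$, where $v_{\mathfrak p}$ is the valuation of the discrete valuation ring $R_{\mathfrak p}$ (with $v_{\mathfrak p}(0)=\infty$). A subset of $\operatorname{Spec}(A)$ has \emph{codimension $\ge c$} if all primes it contains have height $\ge c$. Let $\overline{E}\subset\operatorname{Spec}(B)$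 be the locus where at least two of the following $n+\binom n2$ equations hold: $\eta_i=0$ for $1\le i\le n$, and $\eta_i^2=\eta_j^2$ for $1\le i<j\le n$. Let $E\subset\operatorname{Spec}(A)$ be the image of $\overline{E}$. Let $V(\Delta,\partial\Delta)\subset\operatorname{Spec}(A)$ be the set of points $x$ such that the image of $\Delta$ in the local ring $A_x$ lies in $\mathfrak m_x^2$, where $\mathfrak m_x$ is the maximal ideal of $A_x$. (1) Suppose that $A$ is normal, that $\Delta$ is squarefree and a non-zerodivisor, and that $E$ has codimension $\ge 2$ in $\operatorname{Spec}(A)$. Then $B$ is normal. (2) Suppose that $A$ is normal, that $\Delta$ is a non-zerodivisor, and that $V(\Delta,\partial\Delta)$ has codimension $\ge 2$ in $\operatorname{Spec}(A)$. Then $\Delta$ is squarefree and $B$ is normal. -/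

import Mathlib

open Polynomial

noncomputable section

namespace SignedSplit

universe u

variable {A : Type u} [CommRing A]

/-! ### Normal rings, order of vanishing, codimension -/

/-- A commutative ring is normal if all its localizations at primes are integrally closed
domains. -/
def IsNormalRing (R : Type u) [CommRing R] : Prop :=
  ∀ p : PrimeSpectrum R, IsDomain (Localization.AtPrime p.asIdeal) ∧
    IsIntegrallyClosed (Localization.AtPrime p.asIdeal)

/-- The largest `k` with `x ∈ 𝔪ᵏ` (possibly `∞`) in a local ring. -/
def localOrder {R : Type u} [CommRing R] [IsLocalRing R] (x : R) : ℕ∞ :=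
  ⨆ (k : ℕ) (_ : x ∈ IsLocalRing.maximalIdeal R ^ k), (k : ℕ∞)

/-- In a discrete valuation ring, `localOrder` is the normalized valuation. -/
theorem localOrder_eq_addVal {R : Type u} [CommRing R] [IsDomain R] [IsDiscreteValuationRing R]
    (x : R) : localOrder x = IsDiscreteValuationRing.addVal R x := by
  obtain ⟨ϖ, hϖ⟩ := IsDiscreteValuationRing.exists_irreducible R
  have key : ∀ k : ℕ, x ∈ IsLocalRing.maximalIdeal R ^ k ↔
      (k : ℕ∞) ≤ IsDiscreteValuationRing.addVal R x := by
    intro k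
    rw [hϖ.maximalIdeal_eq, Ideal.span_singleton_pow, Ideal.mem_span_singleton,
      ← IsDiscreteValuationRing.addVal_le_iff_dvd, hϖ.addVal_pow]
  unfold localOrder
  apply le_antisymm
  · exact iSup₂_le fun k hk => (key k).1 hk
  · refine ENat.forall_natCast_le_iff_le.1 fun k hk => ?_
    exact le_iSup₂_of_le k ((key k).2 hk) le_rfl

/-- The order of vanishing `v_𝔭(x)` of `x` at `𝔭`; it is the valuation attached to `𝔭` when the
localization at `𝔭` is a discrete valuation ring, with `v_𝔭(0) = ∞`. -/
def primeOrder (p : PrimeSpectrum A) (x : A) : ℕ∞ :=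
  localOrder (algebraMap A (Localization.AtPrime p.asIdeal) x)

/-- An element (of a normal ring) is squarefree if its valuation at every prime of height one is
`0` or `1`. -/
def IsSquarefreeElt (x : A) : Prop :=
  ∀ p : PrimeSpectrum A, p.asIdeal.height = 1 → primeOrder p x = 0 ∨ primeOrder p x = 1

/-- A subset of `Spec A` has codimension `≥ c` if all primes it contains have height `≥ c`. -/
def CodimGE (S : Set (PrimeSpectrum A)) (c : ℕ) : Prop :=
  ∀ p ∈ S, (c : ℕ∞) ≤ p.asIdeal.height

/-- `V(x, ∂x)`: the set of points `p` of `Spec A` at which `x` vanishes to order two, i.e. the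
image of `x` in the local ring at `p` lies in the square of the maximal ideal. -/
def secondOrderLocus (x : A) : Set (PrimeSpectrum A) :=
  {p | algebraMap A (Localization.AtPrime p.asIdeal) x ∈
    IsLocalRing.maximalIdeal (Localization.AtPrime p.asIdeal) ^ 2}

/-! ### The signed splitting ring -/

/-- `f(u) = ∑_{i=0}^n a_{2n-2i} u^{2i}`. Only the values `a 0, a 2, …, a (2n)` matter. -/
def evenPoly (n : ℕ) (a : ℕ → A) : A[X] :=
  ∑ i ∈ Finset.range (n + 1), C (a (2 * n - 2 * i)) * X ^ (2 * i)

/-- `f̃(v) = ∑_{i=0}^n a_{2n-2i} v^i`, so that `f̃(u²) = f(u)`. -/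
def halfPoly (n : ℕ) (a : ℕ → A) : A[X] :=
  ∑ i ∈ Finset.range (n + 1), C (a (2 * n - 2 * i)) * X ^ i

/-- The ideal of `A[η₁, …, ηₙ]` generated by the coefficients (in `u`) of
`f(u) - ∏ (u² - ηᵢ²)`. -/
def relIdeal (n : ℕ) (a : ℕ → A) : Ideal (MvPolynomial (Fin n) A) :=
  Ideal.span (Set.range fun k : ℕ =>
    ((evenPoly n a).map (MvPolynomial.C : A →+* MvPolynomial (Fin n) A) -
      ∏ i : Fin n, (X ^ 2 - C (MvPolynomial.X i ^ 2))).coeff k)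

/-- The signed splitting ring of `f = ∑ a_{2n-2i} u^{2i}`. -/
def SSplit (n : ℕ) (a : ℕ → A) : Type u :=
  MvPolynomial (Fin n) A ⧸ relIdeal n a

instance SSplit.instCommRing (n : ℕ) (a : ℕ → A) : CommRing (SSplit n a) :=
  inferInstanceAs (CommRing (MvPolynomial (Fin n) A ⧸ relIdeal n a))

instance SSplit.instAlgebra (n : ℕ) (a : ℕ → A) : Algebra A (SSplit n a) :=
  inferInstanceAs (Algebra A (MvPolynomial (Fin n) A ⧸ relIdeal n a))

/-- The quotient map `A[η₁, …, ηₙ] → B`. -/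
def mkHom (n : ℕ) (a : ℕ → A) : MvPolynomial (Fin n) A →ₐ[A] SSplit n a :=
  Ideal.Quotient.mkₐ A (relIdeal n a)

/-- The generator `ηᵢ` of the signed splitting ring. -/
def eta (n : ℕ) (a : ℕ → A) (i : Fin n) : SSplit n a :=
  mkHom n a (MvPolynomial.X i)

/-- `Δ = (-4)ⁿ a_{2n} disc(f̃)`; see `algebraMap_Delta` for the expression
`4ⁿ ∏ ηᵢ² ∏_{i<j} (ηᵢ² - ηⱼ²)²` in terms of the roots. -/
def Delta (n : ℕ) (a : ℕ → A) : A :=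
  (-4) ^ n * a (2 * n) * (halfPoly n a).discr

theorem expand_halfPoly (n : ℕ) (a : ℕ → A) : expand A 2 (halfPoly n a) = evenPoly n a := by
  simp [halfPoly, evenPoly, pow_mul]

/-- The defining factorization `f(u) = ∏ (u² - ηᵢ²)` over the signed splitting ring. -/
theorem map_evenPoly (n : ℕ) (a : ℕ → A) :
    (evenPoly n a).map (algebraMap A (SSplit n a)) =
      ∏ i : Fin n, (X ^ 2 - C (eta n a i ^ 2)) := by
  have h : ((evenPoly n a).map (MvPolynomial.C : A →+* MvPolynomial (Fin n) A) -
      ∏ i : Fin n, (X ^ 2 - C (MvPolynomial.X i ^ 2))).map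
        (mkHom n a : MvPolynomial (Fin n) A →+* SSplit n a) = 0 := by
    ext k
    rw [coeff_map, coeff_zero]
    exact Ideal.Quotient.eq_zero_iff_mem.2 (Ideal.subset_span ⟨k, rfl⟩)
  rw [Polynomial.map_sub, sub_eq_zero, Polynomial.map_map, Polynomial.map_prod] at h
  have hc : (mkHom n a : MvPolynomial (Fin n) A →+* SSplit n a).comp MvPolynomial.C =
      algebraMap A (SSplit n a) := (mkHom n a).comp_algebraMap
  rw [hc] at h
  rw [h]
  simp [eta]

theorem map_halfPoly (n : ℕ) (a : ℕ → A) :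
    (halfPoly n a).map (algebraMap A (SSplit n a)) = ∏ i : Fin n, (X - C (eta n a i ^ 2)) := by
  apply expand_injective (n := 2) (by norm_num)
  rw [← map_expand, expand_halfPoly, map_evenPoly, map_prod]
  refine Finset.prod_congr rfl fun i _ => ?_
  rw [map_sub, expand_X, expand_C]

theorem halfPoly_monic (n : ℕ) (a : ℕ → A) (ha : a 0 = 1) : (halfPoly n a).Monic := by
  unfold halfPoly
  rw [Finset.sum_range_succ, add_comm]
  simp only [Nat.sub_self, ha, map_one, one_mul]
  refine monic_X_pow_add ?_
  refine (degree_sum_le _ _).trans_lt ?_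
  refine (Finset.sup_lt_iff (WithBot.bot_lt_coe n)).2 fun i hi => ?_
  exact (degree_C_mul_X_pow_le _ _).trans_lt (WithBot.coe_lt_coe.2 (Nat.cast_lt.2 (Finset.mem_range.1 hi)))

theorem discr_map_of_monic {R S : Type*} [CommRing R] [CommRing S] [Nontrivial S] (φ : R →+* S)
    {g : R[X]} (hg : g.Monic) : (g.map φ).discr = φ g.discr := by
  have hR : Nontrivial R := φ.domain_nontrivial
  by_cases h0 : g.natDegree = 0
  · rw [hg.natDegree_eq_zero.1 h0, Polynomial.map_one, ← C_1, ← C_1, discr_C, discr_C, map_one]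
  have hd : 0 < g.degree := natDegree_pos_iff_degree_pos.1 (Nat.pos_of_ne_zero h0)
  have hnd : (g.map φ).natDegree = g.natDegree := hg.natDegree_map φ
  have hd' : 0 < (g.map φ).degree :=
    natDegree_pos_iff_degree_pos.1 (by rw [hnd]; exact Nat.pos_of_ne_zero h0)
  have e1 := congrArg φ (resultant_deriv hd)
  have e2 := resultant_deriv hd'
  rw [hnd, derivative_map, resultant_map_map, e1, hg.leadingCoeff, (hg.map φ).leadingCoeff] at e2
  simp only [map_mul, map_pow, map_neg, map_one, mul_one] at e2
  have hu : IsUnit ((-1 : S) ^ (g.natDegree * (g.natDegree - 1) / 2)) := isUnit_one.neg.pow _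
  exact (hu.mul_left_cancel e2).symm

theorem discr_prod_X_sub_C {S : Type*} [CommRing S] [Nontrivial S] (n : ℕ) (r : Fin n → S) :
    (∏ i, (X - C (r i))).discr = ∏ i, ∏ j ∈ Finset.Ioi i, (r i - r j) ^ 2 := by
  rcases Nat.eq_zero_or_pos n with rfl | hn
  · rw [Finset.univ_eq_empty, Finset.prod_empty, Finset.prod_empty, ← C_1, discr_C]
  set g : S[X] := ∏ i, (X - C (r i)) with hgdef
  have hg : g.Monic := monic_prod_of_monic _ _ fun i _ => monic_X_sub_C _
  have hnd : g.natDegree = n := by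
    rw [hgdef, natDegree_prod_of_monic _ _ fun i _ => monic_X_sub_C _]; simp
  have hd : 0 < g.degree := natDegree_pos_iff_degree_pos.1 (by omega)
  have e := resultant_deriv hd
  have hder : g.derivative.natDegree ≤ n - 1 := by
    rw [← hnd]; exact natDegree_derivative_le g
  have e3 : g.resultant g.derivative g.natDegree (n - 1) =
      ∏ i, (X - C (r i)).resultant g.derivative (X - C (r i)).natDegree (n - 1) :=
    resultant_prod_left Finset.univ (fun i => X - C (r i)) g.derivative (n - 1) (by simp) hder
  have e4 : ∀ i, g.derivative.eval (r i) = ∏ j ∈ Finset.univ.erase i, (r i - r j) := by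
    intro i
    rw [hgdef, derivative_prod_finset, eval_finsetSum, Finset.sum_eq_single i]
    · simp [eval_prod]
    · intro j _ hji
      rw [eval_mul, eval_prod, Finset.prod_eq_zero (i := i) (by simp [Ne.symm hji]) (by simp),
        zero_mul]
    · simp
  have e5 : ∏ i, ∏ j ∈ Finset.univ.erase i, (r i - r j) =
      (-1) ^ (n * (n - 1) / 2) * ∏ i, ∏ j ∈ Finset.Ioi i, (r i - r j) ^ 2 := by
    have h1 : ∏ i : Fin n, ∏ j ∈ Finset.univ.erase i, (r i - r j) =
        ∏ i, ∏ j ∈ Finset.Ioi i, ((r i - r j) * (r j - r i)) := by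
      rw [Finset.prod_prod_Ioi_mul_eq_prod_prod_off_diag (fun i j => r j - r i)]
      simp only [Finset.compl_eq_univ_sdiff, Finset.sdiff_singleton_eq_erase]
    have h2 : ∀ i j, (r i - r j) * (r j - r i) = (-1) * (r i - r j) ^ 2 := by
      intro i j; ring
    simp_rw [h1, h2, Finset.prod_mul_distrib, Finset.prod_const, Finset.prod_pow_eq_pow_sum]
    congr 2
    simp only [Fin.card_Ioi]
    rw [Fin.sum_univ_eq_sum_range (fun i => n - 1 - i), Finset.sum_range_reflect (fun i => i),
      Finset.sum_range_id]
  simp only [natDegree_X_sub_C, resultant_X_sub_C_left _ _ _ hder, e4] at e3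
  rw [hnd] at e e3
  rw [e3, e5, hg.leadingCoeff, mul_one] at e
  have hu : IsUnit ((-1 : S) ^ (n * (n - 1) / 2)) := isUnit_one.neg.pow _
  exact (hu.mul_left_cancel e).symm

/-- In the signed splitting ring, `Δ = 4ⁿ ∏ ηᵢ² ∏_{i<j} (ηᵢ² - ηⱼ²)²`. -/
theorem algebraMap_Delta (n : ℕ) (a : ℕ → A) (ha : a 0 = 1) :
    algebraMap A (SSplit n a) (Delta n a) =
      4 ^ n * (∏ i, eta n a i ^ 2) *
        ∏ i, ∏ j ∈ Finset.Ioi i, (eta n a i ^ 2 - eta n a j ^ 2) ^ 2 := by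
  rcases subsingleton_or_nontrivial (SSplit n a) with h | h
  · exact Subsingleton.elim _ _
  have h0 : algebraMap A (SSplit n a) (a (2 * n)) = (-1) ^ n * ∏ i, eta n a i ^ 2 := by
    have h1 := congrArg (fun g => coeff g 0) (map_halfPoly n a)
    rw [coeff_map, coeff_zero_eq_eval_zero, coeff_zero_eq_eval_zero, eval_prod] at h1
    have h2 : (halfPoly n a).eval 0 = a (2 * n) := by
      simp [halfPoly, eval_finsetSum, Finset.sum_range_succ']
    rw [h2] at h1
    rw [h1]
    simp [Finset.prod_neg]
  have h3 : (-4 : SSplit n a) ^ n * (-1) ^ n = 4 ^ n := by rw [← mul_pow]; norm_num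
  rw [Delta, map_mul, map_mul, h0, ← discr_map_of_monic _ (halfPoly_monic n a ha), map_halfPoly,
    discr_prod_X_sub_C, ← h3]
  simp only [map_pow, map_neg, map_ofNat]
  ring

/-- The `n + n(n-1)/2` functions `ηᵢ` and `ηᵢ² - ηⱼ²` (`i < j`) on `Spec B`. -/
def coincidence (n : ℕ) (a : ℕ → A) :
    Fin n ⊕ {p : Fin n × Fin n // p.1 < p.2} → SSplit n a
  | Sum.inl i => eta n a i
  | Sum.inr p => eta n a p.1.1 ^ 2 - eta n a p.1.2 ^ 2

/-- The locus `Ē` in `Spec B` where at least two of the functions `coincidence` vanish. -/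
def upperLocus (n : ℕ) (a : ℕ → A) : Set (PrimeSpectrum (SSplit n a)) :=
  {q | ∃ s t, s ≠ t ∧ coincidence n a s ∈ q.asIdeal ∧ coincidence n a t ∈ q.asIdeal}

/-- The locus `E`, the image of `Ē` in `Spec A`. -/
def lowerLocus (n : ℕ) (a : ℕ → A) : Set (PrimeSpectrum A) :=
  PrimeSpectrum.comap (algebraMap A (SSplit n a)) '' upperLocus n a

end SignedSplit

end

/-! The ring B is finite free over A, since it can be built by adjoining one root at a time.
Freeness makes normality a codimension-one question over A: an element of the generic fibre that is
integral over B but not in B has a denominator s in A, and comparing coordinates in a basis shows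
that the obstruction lives over a height-one prime (`isIntegrallyClosedIn_of_forall_height_eq_one`).
As Δ is invertible on the generic fibre, that fibre is unramified over a field, hence reduced
artinian; a local ring integrally closed in such a ring is an integrally closed domain.

Over a height-one prime p, the ring A_p is a DVR in which Δ has valuation 0 or 1. If Δ is a unit,
all dη_i vanish, B_q is unramified, and a uniformizer of A_p generates its maximal ideal. If Δ is a
uniformizer, exactly one coincidence occurs at q. Let t be η_i or η_j ∓ η_i, whichever vanishes.
Then B_q/(t) is unramified over A, so the maximal ideal of B_q is (Δ, t) = (t) because t divides Δ.
Either way the maximal ideal is generated by a nonzerodivisor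
(`isDomain_and_isIntegrallyClosed_localization`).

The second criterion follows from the first through E ⊆ V(Δ, ∂Δ). A vanishing η together with a
vanishing difference kills both a_{2n} and the discriminant. Two vanishing differences kill all
first minors of the power-sum matrix, whose determinant is the discriminant, and this forces
vanishing to order two. -/

open scoped nonZeroDivisors

/-! ### Freeness and universal property of the signed splitting ring -/

namespace SignedSplit

universe u

/-- Every monic polynomial has a universal factorization `∏ (X - ηᵢ²)`, over a free algebra. -/
theorem exists_universal_factorization (n : ℕ) : ∀ {A : Type u} [CommRing A] [Nontrivial A]
    (g : A[X]), g.Monic → g.natDegree = n →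
    ∃ (B : Type u) (_ : CommRing B) (_ : Algebra A B) (η : Fin n → B),
      Module.Free A B ∧ Module.Finite A B ∧ Nontrivial B ∧
      g.map (algebraMap A B) = ∏ i, (X - C (η i ^ 2)) ∧
      Algebra.adjoin A (Set.range η) = ⊤ ∧
      ∀ (D : Type u) [CommRing D] [Algebra A D] (θ : Fin n → D),
        g.map (algebraMap A D) = ∏ i, (X - C (θ i ^ 2)) → ∃ φ : B →ₐ[A] D, ∀ i, φ (η i) = θ i := by
  induction n with
  | zero =>
    intro A _ _ g hg hn
    have hg1 : g = 1 := hg.natDegree_eq_zero.1 hn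
    refine ⟨A, inferInstance, inferInstance, Fin.elim0, inferInstance, inferInstance,
      inferInstance, by simp [hg1], Subsingleton.elim _ _, fun D _ _ θ _ => ?_⟩
    exact ⟨Algebra.ofId A D, fun i => i.elim0⟩
  | succ n ih =>
    intro A _ _ g hg hn
    -- Adjoining a root r of g(u²) instead of g makes the root r² of g a square; the quotient of g
    -- by X - r² is monic of degree n.
    set f : A[X] := expand A 2 g with hf
    have hfm : f.Monic := hg.expand (by norm_num)
    have hfd : f.natDegree = (n + 1) * 2 := by rw [hf, natDegree_expand, hn]
    let A' := AdjoinRoot f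
    let r : A' := AdjoinRoot.root f
    have hfin : Module.Finite A A' := hfm.finite_adjoinRoot
    have hfree : Module.Free A A' := hfm.free_adjoinRoot
    have hnt : Nontrivial A' := by
      refine Module.nontrivial_of_finrank_pos (R := A) ?_
      rw [(AdjoinRoot.powerBasis' hfm).finrank, AdjoinRoot.powerBasis'_dim, hfd]
      omega
    have hroot : (g.map (algebraMap A A')).IsRoot (r ^ 2) := by
      have h := AdjoinRoot.eval₂_root f
      rw [hf, expand_eq_comp_X_pow, eval₂_comp, eval₂_pow, eval₂_X] at h
      rw [IsRoot, eval_map]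
      exact h
    set g' : A'[X] := g.map (algebraMap A A') /ₘ (X - C (r ^ 2)) with hg'
    have hmul : (X - C (r ^ 2)) * g' = g.map (algebraMap A A') :=
      mul_divByMonic_eq_iff_isRoot.2 hroot
    have hg'm : g'.Monic := (monic_X_sub_C _).of_mul_monic_left (by rw [hmul]; exact hg.map _)
    have hg'd : g'.natDegree = n := by
      have h := congrArg natDegree hmul
      rw [(monic_X_sub_C _).natDegree_mul hg'm, hg.natDegree_map, hn, natDegree_X_sub_C] at h
      omega
    obtain ⟨B, _, _, η, hBfree, hBfin, hBnt, hBmap, hBadj, hBuniv⟩ := ih g' hg'm hg'd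
    let : Algebra A B := Algebra.compHom B (algebraMap A A')
    have : IsScalarTower A A' B := IsScalarTower.of_algebraMap_eq fun _ => rfl
    refine ⟨B, inferInstance, inferInstance, Fin.cons (algebraMap A' B r) η,
      Module.Free.trans (S := A'), Module.Finite.trans A' B, hBnt, ?_, ?_, ?_⟩
    · rw [IsScalarTower.algebraMap_eq A A' B, ← Polynomial.map_map, ← hmul, Polynomial.map_mul,
        hBmap, Fin.prod_univ_succ]
      simp
    · rw [eq_top_iff]
      set S := Algebra.adjoin A (Set.range (Fin.cons (algebraMap A' B r) η : Fin (n + 1) → B))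
      have h1 : ∀ x : A', algebraMap A' B x ∈ S := by
        intro x
        have hx : x ∈ Algebra.adjoin A {AdjoinRoot.root f} := by
          rw [AdjoinRoot.adjoinRoot_eq_top]; trivial
        have : Algebra.adjoin A {AdjoinRoot.root f} ≤ S.comap (IsScalarTower.toAlgHom A A' B) := by
          rw [Algebra.adjoin_le_iff, Set.singleton_subset_iff]
          exact Algebra.subset_adjoin ⟨0, rfl⟩
        exact this hx
      intro b _
      have hb : b ∈ Algebra.adjoin A' (Set.range η) := by rw [hBadj]; trivial
      induction hb using Algebra.adjoin_induction with
      | mem x hx =>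
        obtain ⟨i, rfl⟩ := hx
        exact Algebra.subset_adjoin ⟨i.succ, by simp⟩
      | algebraMap x => exact h1 x
      | add x y _ _ hx hy => exact S.add_mem (hx trivial) (hy trivial)
      | mul x y _ _ hx hy => exact S.mul_mem (hx trivial) (hy trivial)
    · intro D _ _ θ hθ
      have h0 : f.eval₂ (algebraMap A D) (θ 0) = 0 := by
        rw [hf, expand_eq_comp_X_pow, eval₂_comp, eval₂_pow, eval₂_X, ← eval_map, hθ,
          Fin.prod_univ_succ]
        simp
      let ψ : A' →ₐ[A] D := AdjoinRoot.liftAlgHom f (Algebra.ofId A D) (θ 0) h0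
      have hψ : ψ r = θ 0 := AdjoinRoot.liftAlgHom_root _ _ _ _
      let : Algebra A' D := ψ.toRingHom.toAlgebra
      have : IsScalarTower A A' D := IsScalarTower.of_algebraMap_eq fun x => (ψ.commutes x).symm
      have hr : algebraMap A' D r = θ 0 := hψ
      obtain ⟨φ, hφ⟩ := hBuniv D (fun i => θ i.succ) (by
        have h := congrArg (Polynomial.map (algebraMap A' D)) hmul
        rw [Polynomial.map_map, ← IsScalarTower.algebraMap_eq, hθ, Polynomial.map_mul,
          Fin.prod_univ_succ] at h
        have e : (X - C (r ^ 2)).map (algebraMap A' D) = X - C (θ 0 ^ 2) := by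
          rw [Polynomial.map_sub, map_X, Polynomial.map_C, map_pow, hr]
        rw [e] at h
        exact (monic_X_sub_C (θ 0 ^ 2)).isRegular.left h)
      refine ⟨φ.restrictScalars A, fun i => ?_⟩
      refine Fin.cases ?_ (fun i => ?_) i
      · simp [hr]
      · simp [hφ]

variable {A : Type u} [CommRing A] (n : ℕ) (a : ℕ → A)

theorem halfPoly_natDegree [Nontrivial A] (ha : a 0 = 1) : (halfPoly n a).natDegree = n := by
  refine le_antisymm (natDegree_sum_le_of_forall_le _ _ fun i hi => ?_) ?_
  · exact (natDegree_C_mul_X_pow_le _ _).trans (by simpa [Nat.lt_succ_iff] using hi)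
  · refine le_natDegree_of_ne_zero ?_
    simp [halfPoly, coeff_X_pow, ha]

theorem adjoin_range_eta : Algebra.adjoin A (Set.range (eta n a)) = ⊤ := by
  have h : Set.range (eta n a) = mkHom n a '' Set.range MvPolynomial.X := by
    rw [← Set.range_comp]; rfl
  rw [h, ← AlgHom.map_adjoin, MvPolynomial.adjoin_range_X, Algebra.map_top]
  exact (AlgHom.range_eq_top _).2 Ideal.Quotient.mk_surjective

/-- The universal property of the signed splitting ring. -/
theorem exists_algHom {D : Type*} [CommRing D] [Algebra A D] (θ : Fin n → D)
    (h : (halfPoly n a).map (algebraMap A D) = ∏ i, (X - C (θ i ^ 2))) :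
    ∃ φ : SSplit n a →ₐ[A] D, ∀ i, φ (eta n a i) = θ i := by
  refine ⟨Ideal.Quotient.liftₐ (relIdeal n a) (MvPolynomial.aeval θ) ?_, fun i => ?_⟩
  · intro x hx
    change x ∈ RingHom.ker (MvPolynomial.aeval θ : MvPolynomial (Fin n) A →ₐ[A] D)
    refine (Ideal.span_le.2 ?_ : relIdeal n a ≤ _) hx
    rintro _ ⟨k, rfl⟩
    change MvPolynomial.aeval θ _ = 0
    have h2 := congrArg (fun q => coeff (expand D 2 q) k) h
    rw [← map_expand, expand_halfPoly] at h2
    have h3 : ((((evenPoly n a).map (MvPolynomial.C : A →+* MvPolynomial (Fin n) A) -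
      ∏ i : Fin n, (X ^ 2 - C (MvPolynomial.X i ^ 2))).map
        (MvPolynomial.aeval θ : MvPolynomial (Fin n) A →ₐ[A] D).toRingHom)).coeff k = 0 := by
      have hc : (MvPolynomial.aeval θ : MvPolynomial (Fin n) A →ₐ[A] D).toRingHom.comp
        MvPolynomial.C = algebraMap A D := (MvPolynomial.aeval θ).comp_algebraMap
      rw [Polynomial.map_sub, Polynomial.map_map, hc, Polynomial.map_prod, coeff_sub, h2,
        sub_eq_zero]
      simp [map_prod]
    rwa [coeff_map] at h3
  · exact MvPolynomial.aeval_X θ i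

/-- The iterated extension and `SSplit n a` have the same universal property and are both generated
by their roots, so the two comparison maps are mutually inverse. -/
theorem free_and_finite_and_nontrivial [Nontrivial A] (ha : a 0 = 1) :
    Module.Free A (SSplit n a) ∧ Module.Finite A (SSplit n a) ∧ Nontrivial (SSplit n a) := by
  obtain ⟨B, _, _, η, hfree, hfin, hnt, hmap, hadj, huniv⟩ :=
    exists_universal_factorization n (halfPoly n a) (halfPoly_monic n a ha)
      (halfPoly_natDegree n a ha)
  obtain ⟨φ, hφ⟩ := huniv (SSplit n a) (eta n a) (map_halfPoly n a)
  obtain ⟨ψ, hψ⟩ := exists_algHom n a η hmap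
  have h1 : ψ.comp φ = AlgHom.id A B := AlgHom.ext_of_adjoin_eq_top hadj (by
    rintro _ ⟨i, rfl⟩; simp [hφ, hψ])
  have h2 : φ.comp ψ = AlgHom.id A _ := AlgHom.ext_of_adjoin_eq_top (adjoin_range_eta n a) (by
    rintro _ ⟨i, rfl⟩; simp [hφ, hψ])
  let e : B ≃ₐ[A] SSplit n a := AlgEquiv.ofAlgHom φ ψ h2 h1
  exact ⟨Module.Free.of_equiv e.toLinearEquiv, Module.Finite.equiv e.toLinearEquiv,
    e.symm.toEquiv.nontrivial⟩

end SignedSplit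

/-! ### Normality from codimension one -/

/-- In a noetherian integrally closed domain, the associated primes of a nonzero principal ideal
have height one. -/
theorem IsIntegrallyClosed.height_eq_one_of_forall_mem_iff_dvd {A : Type*} [CommRing A]
    [IsDomain A] [IsNoetherianRing A] [IsIntegrallyClosed A] {s x : A} (hs : s ≠ 0) (p : Ideal A)
    [hp : p.IsPrime] (h : ∀ a, a ∈ p ↔ s ∣ a * x) : p.height = 1 := by
  have hsp : s ∈ p := (h s).2 (dvd_mul_right s x)
  have hpb : p ≠ ⊥ := fun e => hs (by simpa [e] using hsp)
  refine le_antisymm ?_ ?_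
  -- Otherwise x/s maps the finitely generated module p into itself, so it is integral, lies in A,
  -- and 1 ∈ p.
  · obtain ⟨a, b, hap, hbp, hab⟩ : ∃ a b, a ∈ p ∧ b ∉ p ∧ a * x = s * b := by
      by_contra! hcon
      let K := FractionRing A
      have hsK : algebraMap A K s ≠ 0 := by simpa using hs
      have hint : IsIntegral A (algebraMap A K x / algebraMap A K s) := by
        refine isIntegral_of_smul_mem_submodule (M := K)
          (Submodule.map (Algebra.linearMap A K) p) ?_ ?_ _ ?_
        · intro e
          have hm : algebraMap A K s ∈ Submodule.map (Algebra.linearMap A K) p := ⟨s, hsp, rfl⟩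
          rw [e, Submodule.mem_bot] at hm
          exact hsK hm
        · exact (IsNoetherian.noetherian p).map _
        · rintro _ ⟨a, ha, rfl⟩
          obtain ⟨b, hb⟩ := (h a).1 ha
          refine ⟨b, by_contra fun hbp => hcon a b ha hbp hb, ?_⟩
          simp only [Algebra.linearMap_apply, smul_eq_mul]
          rw [div_mul_eq_mul_div, eq_div_iff hsK, ← map_mul, ← map_mul, mul_comm x, hb, mul_comm]
      obtain ⟨y, hy⟩ := IsIntegrallyClosed.isIntegral_iff.1 hint
      rw [eq_div_iff hsK, ← map_mul] at hy
      have hxy : y * s = x := FaithfulSMul.algebraMap_injective A K hy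
      exact hp.one_notMem ((h 1).2 ⟨y, by rw [one_mul, ← hxy, mul_comm]⟩)
    -- For c ∈ p with c x = s d one gets c b = a d. As b ∉ p, a prime between (a) and p contains c,
    -- so p is minimal over (a) and Krull's theorem applies.
    refine Ideal.height_le_one_of_isPrincipal_of_mem_minimalPrimes (Ideal.span {a}) p
      ⟨⟨hp, (Ideal.span_singleton_le_iff_mem _).2 hap⟩, ?_⟩
    rintro q ⟨hq, haq⟩ hqp c hc
    have haq' : a ∈ q := (Ideal.span_singleton_le_iff_mem _).1 haq
    have hbq : b ∉ q := fun hb => hbp (hqp hb)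
    obtain ⟨d, hd⟩ := (h c).1 hc
    have hcb : c * b = a * d := mul_left_cancel₀ hs (by
      linear_combination (-c) * hab + a * hd)
    exact (hq.mem_or_mem (hcb ▸ q.mul_mem_right d haq' : c * b ∈ q)).resolve_right hbq
  · rw [Order.one_le_iff_ne_zero, Ne, Ideal.height_eq_zero_iff_eq_bot]
    exact hpb

/-- A finite free algebra over a noetherian integrally closed domain which is normal in
codimension one is integrally closed in its generic fibre. -/
theorem isIntegrallyClosedIn_of_forall_height_eq_one {A B F : Type*} [CommRing A] [IsDomain A]
    [IsNoetherianRing A] [IsIntegrallyClosed A] [CommRing B] [Algebra A B] [Module.Free A B]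
    [Module.Finite A B] [CommRing F] [Algebra B F]
    [IsLocalization (Algebra.algebraMapSubmonoid B A⁰) F]
    (h : ∀ (Q : Ideal B) [Q.IsPrime], (Q.comap (algebraMap A B)).height = 1 →
      IsDomain (Localization.AtPrime Q) ∧ IsIntegrallyClosed (Localization.AtPrime Q)) :
    IsIntegrallyClosedIn B F := by
  have hreg : ∀ s ∈ Algebra.algebraMapSubmonoid B A⁰, s ∈ B⁰ := by
    rintro _ ⟨s, hs, rfl⟩
    rw [mem_nonZeroDivisors_iff_right]
    intro b hb
    have hb' : s • b = 0 := by rwa [Algebra.smul_def, mul_comm]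
    exact (smul_eq_zero.1 hb').resolve_left (nonZeroDivisors.ne_zero hs)
  have hinj : Function.Injective (algebraMap B F) :=
    IsLocalization.injective F (M := Algebra.algebraMapSubmonoid B A⁰) hreg
  rw [isIntegrallyClosedIn_iff]
  refine ⟨hinj, ?_⟩
  by_contra! hcon
  obtain ⟨x₀, hx₀, hx₀'⟩ := hcon
  have : IsNoetherianRing B := isNoetherian_of_tower A inferInstance
  -- If O/B is nonzero it has an associated prime Q, the annihilator of the class of some x = c/s
  -- with s from A; thus Q consists of the b with s ∣ b c.
  let O := integralClosure B F
  let N : Submodule B O := LinearMap.range (Algebra.linearMap B O)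
  have : Nontrivial (O ⧸ N) := by
    rw [Submodule.Quotient.nontrivial_iff]
    intro e
    have hm : (⟨x₀, hx₀⟩ : O) ∈ N := by rw [e]; trivial
    obtain ⟨y, hy⟩ := hm
    exact hx₀' y (congrArg Subtype.val hy)
  obtain ⟨Q, hQ⟩ := associatedPrimes.nonempty B (O ⧸ N)
  obtain ⟨hQp, m, hm⟩ := (Submodule.isAssociatedPrime_iff (N := (⊥ : Submodule B (O ⧸ N)))).1 hQ
  obtain ⟨⟨x, hx⟩, rfl⟩ := Submodule.Quotient.mk_surjective N m
  have hmem : ∀ b, b ∈ Q ↔ ∃ y, algebraMap B F y = algebraMap B F b * x := by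
    intro b
    rw [hm, Submodule.mem_colon_singleton, Submodule.mem_bot, ← Submodule.Quotient.mk_smul,
      Submodule.Quotient.mk_eq_zero]
    refine exists_congr fun y => ?_
    rw [← Subtype.coe_inj]
    simp [Algebra.smul_def]
  obtain ⟨⟨c, _, s, hs, rfl⟩, hcs⟩ :=
    IsLocalization.surj (Algebra.algebraMapSubmonoid B A⁰) x
  have hs0 : s ≠ 0 := nonZeroDivisors.ne_zero hs
  have hsreg := hreg _ ⟨s, hs, rfl⟩
  have hsF : IsUnit (algebraMap B F (algebraMap A B s)) :=
    IsLocalization.map_units F (⟨_, s, hs, rfl⟩ : Algebra.algebraMapSubmonoid B A⁰)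
  have hmem' : ∀ b, b ∈ Q ↔ algebraMap A B s ∣ b * c := by
    intro b
    rw [hmem]
    refine exists_congr fun y => ?_
    rw [← hinj.eq_iff (a := b * c), map_mul, map_mul]
    dsimp only at hcs
    rw [← hcs, ← hsF.mul_left_inj]
    constructor <;> intro e <;> linear_combination -e
  -- Divisibility by s is tested on coordinates, so Q ∩ A is a finite intersection of the ideals (s
  -- : c_i). Being prime, it equals one of them, which has height one.
  let β := Module.Free.chooseBasis A B
  have hdvd : ∀ b : B, algebraMap A B s ∣ b ↔ ∀ i, s ∣ β.repr b i := by
    intro b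
    constructor
    · rintro ⟨b, rfl⟩ i
      rw [← Algebra.smul_def, map_smul]
      exact ⟨_, rfl⟩
    · intro hb
      choose d hd using hb
      refine ⟨∑ i, d i • β i, ?_⟩
      rw [← Algebra.smul_def, Finset.smul_sum]
      conv_lhs => rw [← β.sum_repr b]
      refine Finset.sum_congr rfl fun i _ => ?_
      rw [hd i, mul_smul]
  have hcontr : ∃ i, ∀ a, a ∈ Q.comap (algebraMap A B) ↔ s ∣ a * β.repr c i := by
    let I : Module.Free.ChooseBasisIndex A B → Ideal A := fun i =>
      Submodule.comap (LinearMap.mulRight A (β.repr c i)) (Ideal.span {s})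
    have hI : ∀ i a, a ∈ I i ↔ s ∣ a * β.repr c i := by
      intro i a
      rw [Submodule.mem_comap, Ideal.mem_span_singleton]; rfl
    have hQI : ∀ a, a ∈ Q.comap (algebraMap A B) ↔ ∀ i, a ∈ I i := by
      intro a
      rw [Ideal.mem_comap, hmem', hdvd]
      refine forall_congr' fun i => ?_
      rw [hI, ← Algebra.smul_def, map_smul]; rfl
    obtain ⟨i, -, hi⟩ := (Ideal.IsPrime.inf_le' (s := Finset.univ) (f := I)
      (Ideal.comap_isPrime (algebraMap A B) Q)).1 (by
        intro a ha
        rw [hQI]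
        simpa using ha)
    exact ⟨i, fun a => ⟨fun ha => (hI i a).1 ((hQI a).1 ha i), fun ha => hi ((hI i a).2 ha)⟩⟩
  obtain ⟨i, hi⟩ := hcontr
  obtain ⟨hD, hIC⟩ := h Q (IsIntegrallyClosed.height_eq_one_of_forall_mem_iff_dvd hs0 _ hi)
  -- The image of x is integral over the normal ring B_Q, hence lies in it; clearing denominators
  -- gives an element outside Q that multiplies x into B.
  let R := Localization.AtPrime Q
  let L := FractionRing R
  have hRreg : ∀ b ∈ B⁰, algebraMap B R b ≠ 0 := fun b hb e => by
    obtain ⟨⟨t, ht⟩, hte⟩ := (IsLocalization.map_eq_zero_iff Q.primeCompl R b).1 e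
    exact ht (by
      rw [(mem_nonZeroDivisors_iff_right.1 hb) t hte]; exact Q.zero_mem)
  let ψ : F →+* L := IsLocalization.lift (M := Algebra.algebraMapSubmonoid B A⁰)
    (g := algebraMap B L) (by
      rintro ⟨t, ht⟩
      rw [isUnit_iff_ne_zero, IsScalarTower.algebraMap_apply B R L, Ne,
        FaithfulSMul.algebraMap_eq_zero_iff]
      exact hRreg t (hreg t ht))
  have hψ : ∀ b, ψ (algebraMap B F b) = algebraMap B L b := fun b => IsLocalization.lift_eq _ b
  let ψ' : F →ₐ[B] L := { ψ with commutes' := hψ }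
  have hint : IsIntegral R (ψ x) := (IsIntegral.map ψ' hx).tower_top
  obtain ⟨d, hd⟩ := IsIntegrallyClosed.isIntegral_iff.1 hint
  obtain ⟨b, ⟨u, hu⟩, rfl⟩ := IsLocalization.exists_mk'_eq Q.primeCompl d
  have e1 : algebraMap B L c * algebraMap B L u = algebraMap B L (b * algebraMap A B s) := by
    have e2 := congrArg ψ hcs
    dsimp only at e2
    rw [map_mul, hψ, hψ, ← hd] at e2
    have e3 := congrArg (algebraMap R L) (IsLocalization.mk'_spec R b (⟨u, hu⟩ : Q.primeCompl))
    rw [map_mul, ← IsScalarTower.algebraMap_apply, ← IsScalarTower.algebraMap_apply] at e3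
    dsimp only at e3
    rw [← e2, map_mul, ← e3]
    ring
  rw [← map_mul, IsScalarTower.algebraMap_apply B R L, IsScalarTower.algebraMap_apply B R L,
    (FaithfulSMul.algebraMap_injective R L).eq_iff,
    IsLocalization.eq_iff_exists Q.primeCompl R] at e1
  obtain ⟨⟨v, hv⟩, e4⟩ := e1
  have : v * u ∈ Q := (hmem' _).2 ⟨v * b, by linear_combination e4⟩
  exact (hQp.mem_or_mem this).elim hv hu

/-- A reduced artinian ring in which a local ring is integrally closed is a field. -/
theorem IsIntegrallyClosedIn.isField_of_isArtinianRing {R F : Type*} [CommRing R] [IsLocalRing R]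
    [CommRing F] [Algebra R F] [IsArtinianRing F] [IsReduced F] [IsIntegrallyClosedIn R F] :
    IsField F := by
  have hinj : Function.Injective (algebraMap R F) := IsIntegralClosure.algebraMap_injective R R F
  have : Nontrivial F := hinj.nontrivial
  refine ⟨exists_pair_ne F, mul_comm, fun {x} hx => ?_⟩
  -- The chain of powers of x stabilizes, and reducedness improves x^n = x^(n+1) z to x = x² z; so x
  -- z is idempotent.
  obtain ⟨n, z, hz⟩ := IsArtinian.exists_pow_succ_smul_dvd x (1 : F)
  simp only [smul_eq_mul, mul_one] at hz
  have h0 : x * (1 - x * z) = 0 := by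
    refine IsReduced.eq_zero _ ⟨n + 1, ?_⟩
    have : x ^ n * (1 - x * z) = 0 := by
      rw [Nat.succ_eq_add_one, pow_succ] at hz
      linear_combination -hz
    rw [mul_pow, pow_succ, pow_succ]
    linear_combination (x * (1 - x * z) ^ n) * this
  have he : x * z * (x * z) = x * z := by linear_combination (-z) * h0
  -- An idempotent is a root of X² - X, so it comes from R, where locality leaves only 0 and 1.
  obtain ⟨e, hxe⟩ : ∃ e, algebraMap R F e = x * z :=
    IsIntegrallyClosedIn.algebraMap_eq_of_integral
      ⟨X ^ 2 - X, by monicity!, by simp [pow_two, he]⟩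
  have hee : e * (1 - e) = 0 := hinj (by
    rw [map_mul, map_sub, hxe, map_one, map_zero]; linear_combination -he)
  rcases IsLocalRing.isUnit_or_isUnit_one_sub_self e with hu | hu
  · have : e = 1 := by
      have := (hu.mul_right_eq_zero).1 hee
      exact (sub_eq_zero.1 this).symm
    exact ⟨z, by rw [← hxe, this, map_one]⟩
  · have : e = 0 := (hu.mul_left_eq_zero).1 hee
    rw [this, map_zero] at hxe
    exact absurd (by rw [← hxe] at h0; simpa using h0) hx

/-- The field F contains the fraction field of R, and being integrally closed passes to that smaller
extension. -/
theorem IsIntegrallyClosedIn.isDomain_and_isIntegrallyClosed {R F : Type*} [CommRing R] [CommRing F]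
    [Algebra R F] [IsIntegrallyClosedIn R F] (hF : IsField F) :
    IsDomain R ∧ IsIntegrallyClosed R := by
  let := hF.toField
  have hinj : Function.Injective (algebraMap R F) := IsIntegralClosure.algebraMap_injective R R F
  have hD : IsDomain R := hinj.isDomain
  have : FaithfulSMul R F := (faithfulSMul_iff_algebraMap_injective R F).2 hinj
  refine ⟨hD, ?_⟩
  let φ : FractionRing R →ₐ[R] F := IsFractionRing.liftAlgHom (g := Algebra.ofId R F) hinj
  exact AlgHom.isIntegrallyClosedIn φ φ.toRingHom.injective inferInstance

/-- If `B` is integrally closed in a reduced artinian `B`-algebra, its localizations at primes are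
integrally closed domains. -/
theorem IsIntegrallyClosedIn.localization_atPrime {B F : Type*} [CommRing B] [CommRing F]
    [Algebra B F] [IsArtinianRing F] [IsReduced F] [IsIntegrallyClosedIn B F]
    (Q : Ideal B) [Q.IsPrime] :
    IsDomain (Localization.AtPrime Q) ∧ IsIntegrallyClosed (Localization.AtPrime Q) := by
  have hinj : Function.Injective (algebraMap B F) := IsIntegralClosure.algebraMap_injective B B F
  let M := Q.primeCompl
  let R := Localization.AtPrime Q
  let G := Localization (Algebra.algebraMapSubmonoid F M)
  have : IsLocalization (M.map (algebraMap B F)) G :=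
    inferInstanceAs (IsLocalization (Algebra.algebraMapSubmonoid F M) G)
  have : IsScalarTower B R G := inferInstance
  have : IsReduced G := isReduced_localizationPreserves (Algebra.algebraMapSubmonoid F M) G inferInstance
  have hGinj : Function.Injective (algebraMap R G) :=
    IsLocalization.map_injective_of_injective M R G hinj
  have : IsIntegrallyClosedIn R G := by
    rw [isIntegrallyClosedIn_iff]
    refine ⟨hGinj, fun {x} hx => ?_⟩
    -- Three denominators are cleared: m makes x integral over B, m₁ brings it into the image of F,
    -- and m₂ lifts integrality from G back to F.
    obtain ⟨⟨m, hm⟩, hmx⟩ := IsIntegral.exists_multiple_integral_of_isLocalization M x hx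
    obtain ⟨⟨y, _, m₁, hm₁, rfl⟩, hy⟩ := IsLocalization.surj (Algebra.algebraMapSubmonoid F M) x
    have hxy : algebraMap F G (m • y) = m₁ • m • x := by
      dsimp only at hy
      rw [Algebra.smul_def, map_mul, ← hy, ← IsScalarTower.algebraMap_apply,
        ← IsScalarTower.algebraMap_apply]
      simp only [Algebra.smul_def]
      ring
    obtain ⟨m₂, hm₂, hi⟩ := IsLocalization.exists_isIntegral_smul_of_isIntegral_map (Sₘ := G) M
      (x := m • y) (by rw [hxy]; exact hmx.smul m₁)
    obtain ⟨b, hb⟩ := IsIntegrallyClosedIn.algebraMap_eq_of_integral hi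
    have hb' : algebraMap B G b = algebraMap B G (m₂ * m₁ * m) * x := by
      rw [IsScalarTower.algebraMap_apply B F G, hb, Algebra.smul_def, map_mul, hxy,
        ← IsScalarTower.algebraMap_apply]
      simp only [Algebra.smul_def, map_mul]
      ring
    let t : M := ⟨m₂ * m₁ * m, M.mul_mem (M.mul_mem hm₂ hm₁) hm⟩
    refine ⟨IsLocalization.mk' R b t, ?_⟩
    have ht : IsUnit (algebraMap B G t) := by
      rw [IsScalarTower.algebraMap_apply B R G]
      exact (IsLocalization.map_units R t).map _
    refine ht.mul_left_cancel ?_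
    rw [← hb', IsScalarTower.algebraMap_apply B R G, ← map_mul, mul_comm, IsLocalization.mk'_spec,
      ← IsScalarTower.algebraMap_apply]
  exact IsIntegrallyClosedIn.isDomain_and_isIntegrallyClosed
    (IsIntegrallyClosedIn.isField_of_isArtinianRing (R := R) (F := G))

/-! ### Unramified quotients and principal maximal ideals -/

/-- The maximal ideal of a local algebra essentially of finite type, one of whose quotients is
unramified over the base. -/
theorem Algebra.FormallyUnramified.maximalIdeal_eq_sup {A R : Type*} [CommRing A] [CommRing R]
    [IsLocalRing R] [Algebra A R] [Algebra.EssFiniteType A R] (I : Ideal R)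
    (hI : I ≤ IsLocalRing.maximalIdeal R) [Algebra.FormallyUnramified A (R ⧸ I)] :
    IsLocalRing.maximalIdeal R =
      ((IsLocalRing.maximalIdeal R).comap (algebraMap A R)).map (algebraMap A R) ⊔ I := by
  let p := (IsLocalRing.maximalIdeal R).comap (algebraMap A R)
  have : Nontrivial (R ⧸ I) := Ideal.Quotient.nontrivial_iff.2
    (ne_top_of_le_ne_top (IsLocalRing.maximalIdeal.isMaximal R).ne_top hI)
  have hloc : IsLocalRing (R ⧸ I) :=
    IsLocalRing.of_surjective' (Ideal.Quotient.mk I) Ideal.Quotient.mk_surjective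
  have hmax : (IsLocalRing.maximalIdeal (R ⧸ I)).comap (Ideal.Quotient.mk I) =
      IsLocalRing.maximalIdeal R :=
    IsLocalRing.eq_maximalIdeal
      (Ideal.comap_isMaximal_of_surjective _ Ideal.Quotient.mk_surjective)
  have hmem : ∀ x, x ∈ p ↔ algebraMap A (R ⧸ I) x ∈ IsLocalRing.maximalIdeal (R ⧸ I) := by
    intro x
    rw [Ideal.mem_comap, ← hmax]; rfl
  -- Over the local ring A_p the map to R/I is local and unramified, so the maximal ideal of A_p
  -- generates that of R/I; pulling back to R adds the kernel I.
  let ψ : Localization.AtPrime p →+* R ⧸ I :=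
    IsLocalization.lift (M := p.primeCompl) (g := algebraMap A (R ⧸ I)) (by
      rintro ⟨x, hx⟩
      by_contra hu
      exact hx ((hmem x).2 hu))
  let : Algebra (Localization.AtPrime p) (R ⧸ I) := ψ.toAlgebra
  have : IsScalarTower A (Localization.AtPrime p) (R ⧸ I) :=
    IsScalarTower.of_algebraMap_eq fun x => (IsLocalization.lift_eq _ x).symm
  have : IsLocalHom (algebraMap (Localization.AtPrime p) (R ⧸ I)) := by
    refine ((IsLocalRing.local_hom_TFAE _).out 2 0 rfl rfl).1 ?_
    rw [← Localization.AtPrime.map_eq_maximalIdeal, Ideal.map_map, ← IsScalarTower.algebraMap_eq,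
      Ideal.map_le_iff_le_comap]
    exact fun x hx => (hmem x).1 hx
  have : Algebra.FormallyUnramified (Localization.AtPrime p) (R ⧸ I) := .of_restrictScalars A _ _
  have : Algebra.EssFiniteType A (R ⧸ I) := .comp A R _
  have : Algebra.EssFiniteType (Localization.AtPrime p) (R ⧸ I) := .of_comp A _ _
  have h := Algebra.FormallyUnramified.map_maximalIdeal (R := Localization.AtPrime p) (S := R ⧸ I)
  rw [← Localization.AtPrime.map_eq_maximalIdeal, Ideal.map_map, ← IsScalarTower.algebraMap_eq,
    IsScalarTower.algebraMap_eq A R (R ⧸ I), ← Ideal.map_map] at h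
  refine hmax.symm.trans ?_
  rw [← h, Ideal.Quotient.algebraMap_eq,
    Ideal.comap_map_of_surjective' _ Ideal.Quotient.mk_surjective, Ideal.mk_ker]

/-- A noetherian local ring whose maximal ideal is generated by a non-zerodivisor is an integrally
closed domain. -/
theorem IsLocalRing.isDomain_and_isIntegrallyClosed_of_maximalIdeal_eq_span {R : Type*} [CommRing R]
    [IsNoetherianRing R] [IsLocalRing R] {g : R} (hg : g ∈ R⁰)
    (h : IsLocalRing.maximalIdeal R = Ideal.span {g}) : IsDomain R ∧ IsIntegrallyClosed R := by
  -- By Krull's intersection theorem there is a last power of the maximal ideal containing x; the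
  -- cofactor of that power of g is a unit.
  have hfac : ∀ x : R, x ≠ 0 → ∃ (n : ℕ) (u : R), IsUnit u ∧ x = u * g ^ n := by
    intro x hx
    have hK := Ideal.iInf_pow_eq_bot_of_isLocalRing (IsLocalRing.maximalIdeal R)
      (IsLocalRing.maximalIdeal.isMaximal R).ne_top
    have hex : ∃ n, x ∉ IsLocalRing.maximalIdeal R ^ n := by
      by_contra! hcon
      exact hx (by rwa [← Ideal.mem_iInf, hK, Ideal.mem_bot] at hcon)
    classical
    obtain ⟨m, hm⟩ : ∃ m, Nat.find hex = m + 1 := by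
      refine Nat.exists_eq_succ_of_ne_zero fun h0 => ?_
      have := Nat.find_spec hex
      rw [h0] at this
      simp at this
    have h1 := Nat.find_spec hex
    have h2 : x ∈ IsLocalRing.maximalIdeal R ^ m :=
      not_not.1 (Nat.find_min hex (by omega : m < Nat.find hex))
    rw [hm] at h1
    rw [h, Ideal.span_singleton_pow, Ideal.mem_span_singleton'] at h1 h2
    obtain ⟨u, rfl⟩ := h2
    refine ⟨m, u, ?_, rfl⟩
    by_contra hu
    have hu' : u ∈ IsLocalRing.maximalIdeal R := hu
    rw [h, Ideal.mem_span_singleton'] at hu'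
    obtain ⟨v, rfl⟩ := hu'
    exact h1 ⟨v, by ring⟩
  have hnz : NoZeroDivisors R := by
    refine ⟨fun {x y} hxy => ?_⟩
    by_contra! hcon
    obtain ⟨m, u, hu, rfl⟩ := hfac x hcon.1
    obtain ⟨k, v, hv, rfl⟩ := hfac y hcon.2
    have h1 : (u * v) * g ^ (m + k) = 0 := by rw [← hxy]; ring
    rw [(hu.mul hv).mul_right_eq_zero] at h1
    exact one_ne_zero (α := R)
      ((mem_nonZeroDivisors_iff_right.1 (pow_mem hg (m + k))) 1 (by rw [one_mul, h1]))
  have hD : IsDomain R := NoZeroDivisors.to_isDomain R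
  refine ⟨hD, ?_⟩
  have hp : (IsLocalRing.maximalIdeal R).IsPrincipal := ⟨g, h⟩
  exact (((tfae_of_isNoetherianRing_of_isLocalRing_of_isDomain R).out 4 3 rfl rfl).1 hp).1

/-! ### Differentials of the roots -/

namespace SignedSplit

universe u

variable {A : Type u} [CommRing A] {n : ℕ} {a : ℕ → A} {S : Type*} [CommRing S] [Algebra A S]

theorem map_evenPoly_algHom (φ : SSplit n a →ₐ[A] S) :
    (evenPoly n a).map (algebraMap A S) = ∏ i, (X ^ 2 - C (φ (eta n a i) ^ 2)) := by
  rw [← φ.comp_algebraMap, ← Polynomial.map_map, map_evenPoly, Polynomial.map_prod]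
  simp

theorem map_halfPoly_algHom (φ : SSplit n a →ₐ[A] S) :
    (halfPoly n a).map (algebraMap A S) = ∏ i, (X - C (φ (eta n a i) ^ 2)) := by
  rw [← φ.comp_algebraMap, ← Polynomial.map_map, map_halfPoly, Polynomial.map_prod]
  simp

variable {M : Type*} [AddCommGroup M] [Module A M] [Module S M]

/-- Apply D to f(η_i) = 0; the coefficient is f'(η_i), computed from the factorization of f. -/
theorem derivation_eta (φ : SSplit n a →ₐ[A] S) (D : Derivation A S M) (i : Fin n) :
    (2 * φ (eta n a i) *
      ∏ j ∈ Finset.univ.erase i, (φ (eta n a i) ^ 2 - φ (eta n a j) ^ 2)) •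
        D (φ (eta n a i)) = 0 := by
  have h0 : aeval (φ (eta n a i)) (evenPoly n a) = 0 := by
    rw [aeval_def, ← eval_map, map_evenPoly_algHom φ, eval_prod]
    exact Finset.prod_eq_zero (Finset.mem_univ i) (by simp)
  have h1 : aeval (φ (eta n a i)) (derivative (evenPoly n a)) = 2 * φ (eta n a i) *
      ∏ j ∈ Finset.univ.erase i, (φ (eta n a i) ^ 2 - φ (eta n a j) ^ 2) := by
    rw [aeval_def, ← eval_map, ← derivative_map, map_evenPoly_algHom φ, derivative_prod_finset,
      eval_finsetSum, Finset.sum_eq_single i]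
    · simp [eval_prod, -map_pow]
      ring
    · intro j _ hji
      rw [eval_mul, eval_prod, Finset.prod_eq_zero (i := i) (by simp [Ne.symm hji]) (by simp),
        zero_mul]
    · simp
  rw [← h1, ← Derivation.map_aeval, h0, map_zero]

/-- The sum of the η_i² is, up to sign, a coefficient of `halfPoly n a`, so D kills it. This
supplies the relation missing from `derivation_eta` when two squares coincide. -/
theorem sum_derivation_eta (φ : SSplit n a →ₐ[A] S) (D : Derivation A S M) :
    ∑ i, (2 * φ (eta n a i)) • D (φ (eta n a i)) = 0 := by
  rcases Nat.eq_zero_or_pos n with rfl | hn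
  · simp
  have h1 := congrArg (fun g => coeff g (n - 1)) (map_halfPoly_algHom φ)
  have h2 := prod_X_sub_C_coeff_card_pred (Finset.univ : Finset (Fin n))
    (fun i => φ (eta n a i) ^ 2) (by simpa using hn)
  rw [Finset.card_univ, Fintype.card_fin] at h2
  rw [h2, coeff_map] at h1
  have h3 := congrArg D h1
  rw [Derivation.map_algebraMap, map_neg, map_sum] at h3
  rw [← neg_eq_zero, h3]
  congr 1
  refine Finset.sum_congr rfl fun i _ => ?_
  rw [Derivation.leibniz_pow]
  simp [mul_smul, ofNat_smul_eq_nsmul]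

/-- The roots generate B, so every d(φ b) vanishes. By `hφ` each element of S is a fraction of such
values, and the Leibniz rule kills its differential too. -/
theorem formallyUnramified_of_D_eta_eq_zero (φ : SSplit n a →ₐ[A] S)
    (hφ : ∀ c, ∃ b u, IsUnit (φ u) ∧ φ u * c = φ b)
    (h : ∀ i, KaehlerDifferential.D A S (φ (eta n a i)) = 0) :
    Algebra.FormallyUnramified A S := by
  have h1 : ∀ b, KaehlerDifferential.D A S (φ b) = 0 := by
    intro b
    have hb : b ∈ Algebra.adjoin A (Set.range (eta n a)) := by rw [adjoin_range_eta]; trivial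
    induction hb using Algebra.adjoin_induction with
    | mem x hx => obtain ⟨i, rfl⟩ := hx; exact h i
    | algebraMap x => rw [φ.commutes, Derivation.map_algebraMap]
    | add x y _ _ hx hy => rw [map_add, map_add, hx, hy, add_zero]
    | mul x y _ _ hx hy => rw [map_mul, Derivation.leibniz, hx, hy, smul_zero, smul_zero, add_zero]
  have h2 : ∀ c, KaehlerDifferential.D A S c = 0 := by
    intro c
    obtain ⟨b, u, hu, e⟩ := hφ c
    have := congrArg (KaehlerDifferential.D A S) e
    rw [Derivation.leibniz, h1, h1, smul_zero, add_zero] at this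
    exact (hu.smul_eq_zero).1 this
  rw [Algebra.formallyUnramified_iff]
  refine subsingleton_of_forall_eq 0 fun x => ?_
  have hx : x ∈ Submodule.span S (Set.range (KaehlerDifferential.D A S)) := by
    rw [KaehlerDifferential.span_range_derivation]; trivial
  have : Submodule.span S (Set.range (KaehlerDifferential.D A S)) ≤ ⊥ := by
    rw [Submodule.span_le]
    rintro _ ⟨c, rfl⟩
    exact h2 c
  exact this hx

end SignedSplit

namespace SignedSplit

universe u

variable {A : Type u} [CommRing A] {n : ℕ} {a : ℕ → A}

section Derivation

variable {S : Type*} [CommRing S] [Algebra A S] {M : Type*} [AddCommGroup M] [Module A M]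
  [Module S M] (φ : SSplit n a →ₐ[A] S) (D : Derivation A S M)

theorem derivation_eta_eq_zero_of_isUnit (h2 : IsUnit (2 : S)) (i : Fin n)
    (hi : IsUnit (φ (eta n a i)))
    (hij : ∀ j, j ≠ i → IsUnit (φ (eta n a i) ^ 2 - φ (eta n a j) ^ 2)) :
    D (φ (eta n a i)) = 0 := by
  have hu : IsUnit (2 * φ (eta n a i) *
      ∏ j ∈ Finset.univ.erase i, (φ (eta n a i) ^ 2 - φ (eta n a j) ^ 2)) :=
    (h2.mul hi).mul (IsUnit.prod_iff.2 fun j hj => hij j (Finset.ne_of_mem_erase hj))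
  exact hu.smul_eq_zero.1 (derivation_eta φ D i)

/-- Here `derivation_eta` is vacuous at i and j. In the sum relation only these two terms survive,
and ε² = 1 makes them add up to 4 η_i D η_i instead of cancelling. -/
theorem derivation_eta_eq_zero_of_eq_mul [IsScalarTower A S M] (h2 : IsUnit (2 : S)) {i j : Fin n} (hij : i ≠ j)
    (hi : IsUnit (φ (eta n a i))) (ε : A) (hε : ε ^ 2 = 1)
    (he : φ (eta n a j) = ε • φ (eta n a i))
    (h : ∀ k, k ≠ i → k ≠ j → D (φ (eta n a k)) = 0) (k : Fin n) : D (φ (eta n a k)) = 0 := by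
  have hj : D (φ (eta n a j)) = ε • D (φ (eta n a i)) := by rw [he, Derivation.map_smul]
  have h0 : D (φ (eta n a i)) = 0 := by
    have hs := sum_derivation_eta φ D
    rw [← Finset.add_sum_erase _ _ (Finset.mem_univ i),
      ← Finset.add_sum_erase _ _ (Finset.mem_erase.2 ⟨hij.symm, Finset.mem_univ j⟩),
      Finset.sum_eq_zero, add_zero, hj, he] at hs
    · have e : (2 * φ (eta n a i)) • D (φ (eta n a i)) +
          (2 * ε • φ (eta n a i)) • ε • D (φ (eta n a i)) =
            (2 * 2 * φ (eta n a i)) • D (φ (eta n a i)) := by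
        have e1 : (2 * ε • φ (eta n a i)) • ε • D (φ (eta n a i)) =
            (ε ^ 2) • (2 * φ (eta n a i)) • D (φ (eta n a i)) := by
          rw [Algebra.smul_def, ← algebraMap_smul S ε (D _), smul_smul, ← algebraMap_smul S (ε ^ 2),
            smul_smul, map_pow]
          congr 1
          ring
        rw [e1, hε, one_smul, ← add_smul]
        congr 1
        ring
      rw [e] at hs
      exact ((h2.mul h2).mul hi).smul_eq_zero.1 hs
    · intro k hk
      rw [Finset.mem_erase, Finset.mem_erase] at hk
      rw [h k hk.2.1 hk.1, smul_zero]
  by_cases hki : k = i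
  · rw [hki, h0]
  by_cases hkj : k = j
  · rw [hkj, hj, h0, smul_zero]
  exact h k hki hkj

end Derivation

theorem eta_dvd_Delta (ha : a 0 = 1) (i : Fin n) :
    eta n a i ∣ algebraMap A (SSplit n a) (Delta n a) := by
  rw [algebraMap_Delta n a ha]
  exact ((dvd_pow_self _ two_ne_zero).trans (Finset.dvd_prod_of_mem
    (fun i => eta n a i ^ 2) (Finset.mem_univ i))).trans (dvd_mul_of_dvd_left (dvd_mul_left _ _) _)

theorem sub_dvd_Delta (ha : a 0 = 1) {i j : Fin n} (hij : i < j) :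
    eta n a i ^ 2 - eta n a j ^ 2 ∣ algebraMap A (SSplit n a) (Delta n a) := by
  rw [algebraMap_Delta n a ha]
  refine dvd_mul_of_dvd_right ?_ _
  refine dvd_trans ?_ (Finset.dvd_prod_of_mem _ (Finset.mem_univ i))
  exact (dvd_pow_self _ two_ne_zero).trans
    (Finset.dvd_prod_of_mem (fun j => (eta n a i ^ 2 - eta n a j ^ 2) ^ 2) (Finset.mem_Ioi.2 hij))

theorem coincidence_dvd_Delta (ha : a 0 = 1) (s) :
    coincidence n a s ∣ algebraMap A (SSplit n a) (Delta n a) := by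
  rcases s with i | ⟨p, hp⟩
  · exact eta_dvd_Delta ha i
  · exact sub_dvd_Delta ha hp

/-- A prime containing Δ contains one of its factors, and 4^n is excluded. The guard `0 < n` is
there because for n = 0 one has Δ = 1, which says nothing about 2. -/
theorem exists_coincidence_mem (ha : a 0 = 1) (q : Ideal (SSplit n a)) [hq : q.IsPrime]
    (h2 : 0 < n → (2 : SSplit n a) ∉ q)
    (hΔ : algebraMap A (SSplit n a) (Delta n a) ∈ q) : ∃ s, coincidence n a s ∈ q := by
  rw [algebraMap_Delta n a ha] at hΔ
  rcases hq.mem_or_mem hΔ with h | h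
  · rcases hq.mem_or_mem h with h | h
    · exfalso
      rcases Nat.eq_zero_or_pos n with rfl | hn
      · exact hq.one_notMem (by simpa using h)
      · have h4 := hq.mem_of_pow_mem _ h
        refine h2 hn (hq.mem_of_pow_mem 2 ?_)
        convert h4 using 1
        norm_num
    · obtain ⟨i, -, hi⟩ := hq.prod_mem_iff.1 h
      exact ⟨Sum.inl i, hq.mem_of_pow_mem _ hi⟩
  · obtain ⟨i, -, hi⟩ := hq.prod_mem_iff.1 h
    obtain ⟨j, hj, hij⟩ := hq.prod_mem_iff.1 hi
    exact ⟨Sum.inr ⟨(i, j), Finset.mem_Ioi.1 hj⟩, hq.mem_of_pow_mem _ hij⟩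

section Quotient

variable (q : Ideal (SSplit n a)) [q.IsPrime] (I : Ideal (Localization.AtPrime q))

/-- The structure map from `B` to a quotient of its localization at `q`. -/
noncomputable abbrev toLocalizationQuotient : SSplit n a →ₐ[A] Localization.AtPrime q ⧸ I :=
  (Ideal.Quotient.mkₐ A I).comp (IsScalarTower.toAlgHom A (SSplit n a) (Localization.AtPrime q))

theorem isUnit_toLocalizationQuotient {b : SSplit n a} (hb : b ∉ q) :
    IsUnit (toLocalizationQuotient q I b) :=
  (IsLocalization.map_units (Localization.AtPrime q) (⟨b, hb⟩ : q.primeCompl)).map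
    (Ideal.Quotient.mk I)

theorem formallyUnramified_localization_quotient
    (h : ∀ i, KaehlerDifferential.D A (Localization.AtPrime q ⧸ I)
      (toLocalizationQuotient q I (eta n a i)) = 0) :
    Algebra.FormallyUnramified A (Localization.AtPrime q ⧸ I) := by
  refine formallyUnramified_of_D_eta_eq_zero (toLocalizationQuotient q I) (fun c => ?_) h
  obtain ⟨r, rfl⟩ := Ideal.Quotient.mk_surjective c
  obtain ⟨b, u, rfl⟩ := IsLocalization.exists_mk'_eq q.primeCompl r
  refine ⟨b, u, isUnit_toLocalizationQuotient q I u.2, ?_⟩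
  change Ideal.Quotient.mk I _ * Ideal.Quotient.mk I _ = Ideal.Quotient.mk I _
  rw [← map_mul]
  congr 1
  exact (mul_comm _ _).trans (IsLocalization.mk'_spec _ b u)

/-- A coordinate none of whose coincidences lies in `q` has zero differential. -/
theorem D_eta_eq_zero_of_forall_notMem (h2 : 0 < n → (2 : SSplit n a) ∉ q) (i : Fin n)
    (hi : coincidence n a (Sum.inl i) ∉ q)
    (hij : ∀ p, p.1.1 = i ∨ p.1.2 = i → coincidence n a (Sum.inr p) ∉ q) :
    KaehlerDifferential.D A (Localization.AtPrime q ⧸ I)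
      (toLocalizationQuotient q I (eta n a i)) = 0 := by
  refine derivation_eta_eq_zero_of_isUnit _ _ ?_ i (isUnit_toLocalizationQuotient q I hi) ?_
  · have := isUnit_toLocalizationQuotient q I (h2 i.pos)
    rwa [map_ofNat] at this
  · intro j hji
    rw [← map_pow, ← map_pow, ← map_sub]
    refine isUnit_toLocalizationQuotient q I ?_
    rcases lt_or_gt_of_ne hji with h | h
    · have := hij ⟨(j, i), h⟩ (Or.inr rfl)
      rw [← neg_sub, Ideal.neg_mem_iff]
      exact this
    · exact hij ⟨(i, j), h⟩ (Or.inl rfl)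

end Quotient

/-- Where at most one coincidence occurs, a suitable divisor `t` of `Δ` cuts out an unramified
subscheme. -/
theorem exists_formallyUnramified_quotient (ha : a 0 = 1) (q : Ideal (SSplit n a)) [hq : q.IsPrime]
    (h2 : 0 < n → (2 : SSplit n a) ∉ q)
    (hE : ∀ s t, s ≠ t → coincidence n a s ∈ q → coincidence n a t ∉ q)
    (hΔ : algebraMap A (SSplit n a) (Delta n a) ∈ q) :
    ∃ t ∈ q, t ∣ algebraMap A (SSplit n a) (Delta n a) ∧
      Algebra.FormallyUnramified A (Localization.AtPrime q ⧸
        Ideal.span {algebraMap (SSplit n a) (Localization.AtPrime q) t}) := by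
  obtain ⟨s, hs⟩ := exists_coincidence_mem ha q h2 hΔ
  have hne : ∀ t, t ≠ s → coincidence n a t ∉ q := fun t hts => hE s t hts.symm hs
  rcases s with i | ⟨⟨i, j⟩, hij⟩
  -- With t = η_i the coordinate η_i becomes zero in the quotient, and the other coordinates are
  -- involved in no coincidence at q.
  · refine ⟨eta n a i, hs, eta_dvd_Delta ha i, ?_⟩
    refine formallyUnramified_localization_quotient q _ fun k => ?_
    by_cases hki : k = i
    · have h0 : toLocalizationQuotient q
          (Ideal.span {algebraMap (SSplit n a) (Localization.AtPrime q) (eta n a i)})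
          (eta n a k) = 0 := by
        rw [hki]
        exact Ideal.Quotient.eq_zero_iff_mem.2 (Ideal.mem_span_singleton_self _)
      rw [h0, map_zero]
    · exact D_eta_eq_zero_of_forall_notMem q _ h2 k (hne _ (by simpa using hki))
        fun p _ => hne _ (by simp)
  · have hi : eta n a i ∉ q := hne (Sum.inl i) (by simp)
    -- The difference of squares splits into two linear factors; ε = ±1 selects one lying in q, and
    -- this factor is t.
    obtain ⟨ε, hε, hεq⟩ : ∃ ε : A, ε ^ 2 = 1 ∧ eta n a j - ε • eta n a i ∈ q ∧
        eta n a j - ε • eta n a i ∣ eta n a i ^ 2 - eta n a j ^ 2 := by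
      have hs' : (eta n a j - eta n a i) * (eta n a j + eta n a i) ∈ q := by
        have : (eta n a j - eta n a i) * (eta n a j + eta n a i) =
          -(eta n a i ^ 2 - eta n a j ^ 2) := by ring
        rw [this, Ideal.neg_mem_iff]
        exact hs
      rcases hq.mem_or_mem hs' with h | h
      · exact ⟨1, by ring, by simpa using h, -(eta n a j + eta n a i), by rw [one_smul]; ring⟩
      · exact ⟨-1, by ring, by simpa using h, -(eta n a j - eta n a i), by
          rw [neg_smul, one_smul]; ring⟩
    refine ⟨eta n a j - ε • eta n a i, hεq.1, hεq.2.trans (sub_dvd_Delta ha hij), ?_⟩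
    set I := Ideal.span {algebraMap (SSplit n a) (Localization.AtPrime q)
      (eta n a j - ε • eta n a i)} with hI
    refine formallyUnramified_localization_quotient q _ ?_
    refine derivation_eta_eq_zero_of_eq_mul _ _ ?_ (ne_of_lt hij)
      (isUnit_toLocalizationQuotient q _ hi) ε hε ?_ ?_
    · have := isUnit_toLocalizationQuotient q I (h2 i.pos)
      rwa [map_ofNat] at this
    · rw [← map_smul, ← sub_eq_zero, ← map_sub]
      exact Ideal.Quotient.eq_zero_iff_mem.2 (Ideal.mem_span_singleton_self _)
    · intro k hki hkj
      refine D_eta_eq_zero_of_forall_notMem q _ h2 k (hne _ (by simp)) fun p hp => hne _ ?_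
      rintro heq
      obtain rfl := Sum.inr.inj heq
      rcases hp with h | h
      · exact hki h.symm
      · exact hkj h.symm

/-- Away from Δ there is no coincidence, so `derivation_eta` alone kills every dη_i. The case needed
later is `I = ⊥`. -/
theorem formallyUnramified_localization (ha : a 0 = 1) (q : Ideal (SSplit n a)) [hq : q.IsPrime]
    (h2 : 0 < n → (2 : SSplit n a) ∉ q)
    (hΔ : algebraMap A (SSplit n a) (Delta n a) ∉ q) (I : Ideal (Localization.AtPrime q)) :
    Algebra.FormallyUnramified A (Localization.AtPrime q ⧸ I) := by
  have hne : ∀ s, coincidence n a s ∉ q := fun s hs =>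
    hΔ (q.mem_of_dvd (coincidence_dvd_Delta ha s) hs)
  exact formallyUnramified_localization_quotient q I fun i =>
    D_eta_eq_zero_of_forall_notMem q I h2 i (hne _) fun p _ => hne _

end SignedSplit

/-! ### Second-order vanishing of Δ along E -/

/-- If all the first minors of a square matrix lie in a prime `p`, then its determinant vanishes
to order two at `p`. -/
theorem Matrix.algebraMap_det_mem_maximalIdeal_sq {A ι : Type*} [CommRing A] [Fintype ι]
    [DecidableEq ι] (T : Matrix ι ι A) (p : Ideal A) [hp : p.IsPrime] (hdet : T.det ∈ p)
    (hadj : ∀ i j, T.adjugate i j ∈ p) :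
    algebraMap A (Localization.AtPrime p) T.det ∈
      IsLocalRing.maximalIdeal (Localization.AtPrime p) ^ 2 := by
  -- Modulo p the matrix has a nonzero kernel vector; let w lift it. Then det(T) w = adj(T)(T w) has
  -- entries in p², and some w_i is a unit at p.
  obtain ⟨v, hv0, hv⟩ := (Matrix.exists_mulVec_eq_zero_iff
    (M := T.map (Ideal.Quotient.mk p))).2 (by
      rw [← RingHom.mapMatrix_apply, ← RingHom.map_det]
      exact Ideal.Quotient.eq_zero_iff_mem.2 hdet)
  choose w hw using fun i => Ideal.Quotient.mk_surjective (v i)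
  obtain rfl : (fun i => Ideal.Quotient.mk p (w i)) = v := funext hw
  obtain ⟨i, hi⟩ := Function.ne_iff.1 hv0
  have hTw : ∀ j, T.mulVec w j ∈ p := by
    intro j
    have := congrFun hv j
    rw [← Ideal.Quotient.eq_zero_iff_mem, RingHom.map_mulVec]
    exact this
  have hmem : w i * T.det ∈ p ^ 2 := by
    have h1 : T.adjugate.mulVec (T.mulVec w) i = w i * T.det := by
      rw [Matrix.mulVec_mulVec, Matrix.adjugate_mul, Matrix.smul_mulVec, Matrix.one_mulVec,
        Pi.smul_apply, smul_eq_mul, mul_comm]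
    rw [← h1, pow_two]
    exact Ideal.sum_mem _ fun j _ => Ideal.mul_mem_mul (hadj i j) (hTw j)
  have hu : IsUnit (algebraMap A (Localization.AtPrime p) (w i)) :=
    IsLocalization.map_units _ (⟨w i, fun h => hi (Ideal.Quotient.eq_zero_iff_mem.2 h)⟩ :
      p.primeCompl)
  have h2 := Ideal.mem_map_of_mem (algebraMap A (Localization.AtPrime p)) hmem
  rw [Ideal.map_pow, Localization.AtPrime.map_eq_maximalIdeal, map_mul] at h2
  exact (Ideal.unit_mul_mem_iff_mem _ hu).1 h2

/-- A symmetric polynomial in the roots of a polynomial over `A` has value in `A`. -/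
theorem MvPolynomial.IsSymmetric.aeval_mem_range_algebraMap {A B : Type*} [CommRing A] [CommRing B]
    [Algebra A B] {n : ℕ} (x : Fin n → B) (g : A[X])
    (hg : g.map (algebraMap A B) = ∏ i, (Polynomial.X - Polynomial.C (x i)))
    {P : MvPolynomial (Fin n) A} (hP : P.IsSymmetric) :
    MvPolynomial.aeval x P ∈ Set.range (algebraMap A B) := by
  obtain ⟨Q, hQ⟩ := MvPolynomial.esymmAlgHom_surjective (σ := Fin n) A (n := n) (by simp) ⟨P, hP⟩
  have hQ' : MvPolynomial.aeval (fun i : Fin n => MvPolynomial.esymm (Fin n) A (i + 1)) Q = P := by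
    rw [← MvPolynomial.esymmAlgHom_apply, hQ]
  -- P is a polynomial in the elementary symmetric ones, whose values at the roots are, up to sign,
  -- coefficients of g.
  have hes : ∀ k ≤ n, MvPolynomial.aeval x (MvPolynomial.esymm (Fin n) A k) ∈
      (⊥ : Subalgebra A B) := by
    intro k hk
    rw [MvPolynomial.aeval_esymm_eq_multiset_esymm]
    have h1 := Multiset.prod_X_sub_C_coeff (Finset.univ.val.map x) (k := n - k) (by simp)
    have h2 : (Multiset.map (fun t => Polynomial.X - Polynomial.C t)
        (Finset.univ.val.map x)).prod = g.map (algebraMap A B) := by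
      rw [hg, Multiset.map_map]; rfl
    rw [h2, Polynomial.coeff_map] at h1
    simp only [Multiset.card_map, Finset.card_val, Finset.card_univ, Fintype.card_fin,
      Nat.sub_sub_self hk] at h1
    have h3 : (Finset.univ.val.map x).esymm k = (-1) ^ k * algebraMap A B (g.coeff (n - k)) := by
      rw [h1, ← mul_assoc, ← mul_pow]; simp
    rw [h3]
    exact Subalgebra.mul_mem _ (Subalgebra.pow_mem _ (Subalgebra.neg_mem _ (one_mem _)) _)
      (Subalgebra.algebraMap_mem _ _)
  have h4 : MvPolynomial.aeval x P = MvPolynomial.aeval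
      (fun i : Fin n => MvPolynomial.aeval x (MvPolynomial.esymm (Fin n) A (i + 1))) Q := by
    rw [← hQ', ← AlgHom.comp_apply, MvPolynomial.comp_aeval]
  rw [← Algebra.mem_bot, h4]
  have h5 : MvPolynomial.aeval
      (fun i : Fin n => MvPolynomial.aeval x (MvPolynomial.esymm (Fin n) A (i + 1))) Q ∈
      Algebra.adjoin A (Set.range fun i : Fin n =>
        MvPolynomial.aeval x (MvPolynomial.esymm (Fin n) A (i + 1))) := by
    rw [Algebra.adjoin_range_eq_range_aeval]; exact ⟨Q, rfl⟩
  refine (Algebra.adjoin_le_iff.2 ?_ : _ ≤ (⊥ : Subalgebra A B)) h5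
  rintro _ ⟨i, rfl⟩
  exact hes _ i.2

/-- If two of the differences `xᵢ - xⱼ` lie in a prime `q`, so do all first minors of the
Vandermonde matrix. -/
theorem Matrix.adjugate_vandermonde_mem {B : Type*} [CommRing B] {n : ℕ} (x : Fin n → B)
    (q : Ideal B) (s t : {p : Fin n × Fin n // p.1 < p.2}) (hst : s ≠ t)
    (hs : x s.1.1 - x s.1.2 ∈ q) (ht : x t.1.1 - x t.1.2 ∈ q) (i j : Fin n) :
    (Matrix.vandermonde x).adjugate i j ∈ q := by
  -- The minor omits row j. Either one of the two pairs avoids j, or both contain it and their other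
  -- endpoints are congruent through x_j. In both cases two surviving rows agree modulo q.
  obtain ⟨k, l, hkl, hkj, hlj, hmem⟩ : ∃ k l, k ≠ l ∧ k ≠ j ∧ l ≠ j ∧ x k - x l ∈ q := by
    obtain ⟨⟨a, b⟩, hab⟩ := s
    obtain ⟨⟨c, d⟩, hcd⟩ := t
    have hst' : ¬ (a = c ∧ b = d) := by
      rintro ⟨rfl, rfl⟩; exact hst rfl
    dsimp only at *
    have hs' : x b - x a ∈ q := by rw [← neg_sub]; exact q.neg_mem hs
    have ht' : x d - x c ∈ q := by rw [← neg_sub]; exact q.neg_mem ht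
    by_cases ha : a = j
    · by_cases hc : c = j
      · refine ⟨b, d, ?_, ?_, ?_, ?_⟩
        · rintro rfl; exact hst' ⟨ha.trans hc.symm, rfl⟩
        · rintro rfl; exact hab.ne ha
        · rintro rfl; exact hcd.ne hc
        · have := q.add_mem hs' ht
          rw [ha, hc] at this
          simpa using this
      · by_cases hd : d = j
        · refine ⟨b, c, ?_, ?_, hc, ?_⟩
          · rintro rfl; rw [ha] at hab; rw [hd] at hcd; exact lt_asymm hab hcd
          · rintro rfl; exact hab.ne ha
          · have := q.add_mem hs' ht'
            rw [ha, hd] at this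
            simpa using this
        · exact ⟨c, d, hcd.ne, hc, hd, ht⟩
    · by_cases hb : b = j
      · by_cases hc : c = j
        · refine ⟨a, d, ?_, ha, ?_, ?_⟩
          · rintro rfl; rw [hb] at hab; rw [hc] at hcd; exact lt_asymm hab hcd
          · rintro rfl; exact hcd.ne hc
          · have := q.add_mem hs ht
            rw [hb, hc] at this
            simpa using this
        · by_cases hd : d = j
          · refine ⟨a, c, ?_, ha, hc, ?_⟩
            · rintro rfl; exact hst' ⟨rfl, hb.trans hd.symm⟩
            · have := q.add_mem hs ht'
              rw [hb, hd] at this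
              simpa using this
          · exact ⟨c, d, hcd.ne, hc, hd, ht⟩
      · exact ⟨a, b, hab.ne, ha, hb, hs⟩
  rw [Matrix.adjugate_apply, ← Ideal.Quotient.eq_zero_iff_mem, RingHom.map_det]
  refine Matrix.det_zero_of_row_eq hkl ?_
  ext m
  simp only [RingHom.mapMatrix_apply, Matrix.map_apply, Matrix.updateRow_ne hkj,
    Matrix.updateRow_ne hlj, Matrix.vandermonde_apply, map_pow]
  rw [Ideal.Quotient.eq.2 hmem]

namespace SignedSplit

universe u

variable {A : Type u} [CommRing A] {n : ℕ} {a : ℕ → A}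

theorem algebraMap_discr [Nontrivial (SSplit n a)] (ha : a 0 = 1) :
    algebraMap A (SSplit n a) (halfPoly n a).discr =
      ∏ i, ∏ j ∈ Finset.Ioi i, (eta n a i ^ 2 - eta n a j ^ 2) ^ 2 := by
  rw [← discr_map_of_monic _ (halfPoly_monic n a ha), map_halfPoly, discr_prod_X_sub_C]

theorem algebraMap_constantCoeff : algebraMap A (SSplit n a) (a (2 * n)) =
    (-1) ^ n * ∏ i, eta n a i ^ 2 := by
  have h1 := congrArg (fun g => eval 0 g) (map_halfPoly n a)
  have h2 : (halfPoly n a).eval 0 = a (2 * n) := by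
    simp [halfPoly, eval_finsetSum, Finset.sum_range_succ']
  rw [eval_prod, ← map_zero (algebraMap A (SSplit n a)), eval_map_apply, h2] at h1
  rw [h1]
  simp [Finset.prod_neg]

/-- The discriminant is the determinant of the matrix of power sums. -/
theorem exists_matrix_discr [Nontrivial A] (ha : a 0 = 1) : ∃ T : Matrix (Fin n) (Fin n) A,
    T.det = (halfPoly n a).discr ∧ T.map (algebraMap A (SSplit n a)) =
      (Matrix.vandermonde fun i => eta n a i ^ 2).transpose *
        Matrix.vandermonde fun i => eta n a i ^ 2 := by
  obtain ⟨hfree, -, hnt⟩ := free_and_finite_and_nontrivial n a ha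
  have hinj := FaithfulSMul.algebraMap_injective A (SSplit n a)
  have hps : ∀ m, ∃ c, algebraMap A (SSplit n a) c = ∑ k, (eta n a k ^ 2) ^ m := by
    intro m
    have := (MvPolynomial.psum_isSymmetric (Fin n) A m).aeval_mem_range_algebraMap
      (fun i => eta n a i ^ 2) (halfPoly n a) (map_halfPoly n a)
    simpa [MvPolynomial.psum] using this
  choose c hc using hps
  -- The Gram matrix VᵀV of the Vandermonde matrix has power sums as entries, so it descends to A
  -- although V does not.
  have hT : (Matrix.of fun i j : Fin n => c (i + j)).map (algebraMap A (SSplit n a)) =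
      (Matrix.vandermonde fun i => eta n a i ^ 2).transpose *
        Matrix.vandermonde fun i => eta n a i ^ 2 := by
    ext i j
    simp [Matrix.mul_apply, hc, Matrix.vandermonde_apply, pow_add]
  refine ⟨_, hinj ?_, hT⟩
  rw [RingHom.map_det, RingHom.mapMatrix_apply, hT, Matrix.det_mul, Matrix.det_transpose,
    Matrix.det_vandermonde, algebraMap_discr ha, ← pow_two]
  simp only [← Finset.prod_pow]
  refine Finset.prod_congr rfl fun i _ => Finset.prod_congr rfl fun j _ => ?_
  ring

theorem discr_mem_of_coincidence_mem (ha : a 0 = 1) (q : Ideal (SSplit n a)) [hq : q.IsPrime]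
    (s : {p : Fin n × Fin n // p.1 < p.2}) (hs : coincidence n a (Sum.inr s) ∈ q) :
    algebraMap A (SSplit n a) (halfPoly n a).discr ∈ q := by
  have : Nontrivial (SSplit n a) := ⟨⟨0, 1, fun h => hq.one_notMem (h ▸ q.zero_mem)⟩⟩
  rw [algebraMap_discr ha]
  refine q.mem_of_dvd ?_ hs
  refine dvd_trans ?_ (Finset.dvd_prod_of_mem _ (Finset.mem_univ s.1.1))
  exact (dvd_pow_self _ two_ne_zero).trans (Finset.dvd_prod_of_mem
    (fun j => (eta n a s.1.1 ^ 2 - eta n a j ^ 2) ^ 2) (Finset.mem_Ioi.2 s.2))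

/-- `E ⊆ V(Δ, ∂Δ)`. -/
theorem lowerLocus_subset_secondOrderLocus (ha : a 0 = 1) :
    lowerLocus n a ⊆ secondOrderLocus (Delta n a) := by
  rintro _ ⟨q, ⟨s, t, hst, hs, ht⟩, rfl⟩
  have hq := q.isPrime
  have : Nontrivial (SSplit n a) := ⟨⟨0, 1, fun h => hq.one_notMem (h ▸ q.asIdeal.zero_mem)⟩⟩
  have : Nontrivial A := (algebraMap A (SSplit n a)).domain_nontrivial
  set p := PrimeSpectrum.comap (algebraMap A (SSplit n a)) q
  change algebraMap A (Localization.AtPrime p.asIdeal) (Delta n a) ∈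
    IsLocalRing.maximalIdeal (Localization.AtPrime p.asIdeal) ^ 2
  have hmem : ∀ x, algebraMap A (SSplit n a) x ∈ q.asIdeal →
      algebraMap A (Localization.AtPrime p.asIdeal) x ∈
        IsLocalRing.maximalIdeal (Localization.AtPrime p.asIdeal) := fun x hx =>
    (IsLocalization.AtPrime.to_map_mem_maximal_iff _ p.asIdeal x).2 hx
  -- Both a_{2n} and the discriminant lie in p, so their product is in the square of the maximal
  -- ideal.
  have hmixed : ∀ i u, coincidence n a (Sum.inl i) ∈ q.asIdeal →
      coincidence n a (Sum.inr u) ∈ q.asIdeal →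
      algebraMap A (Localization.AtPrime p.asIdeal) (Delta n a) ∈
        IsLocalRing.maximalIdeal (Localization.AtPrime p.asIdeal) ^ 2 := by
    intro i u hi hu
    rw [Delta, mul_assoc, map_mul, map_mul, pow_two]
    refine Ideal.mul_mem_left _ _ (Ideal.mul_mem_mul (hmem _ ?_)
      (hmem _ (discr_mem_of_coincidence_mem ha q.asIdeal u hu)))
    rw [algebraMap_constantCoeff]
    exact Ideal.mul_mem_left _ _ (q.asIdeal.mem_of_dvd
      ((dvd_pow_self _ two_ne_zero).trans (Finset.dvd_prod_of_mem
        (fun i => eta n a i ^ 2) (Finset.mem_univ i))) hi)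
  rcases s with i | s <;> rcases t with j | t
  -- Two vanishing roots also have equal squares, which reduces to the mixed case.
  · have hij : i ≠ j := fun h => hst (congrArg _ h)
    have hi2 : eta n a i ^ 2 ∈ q.asIdeal := q.asIdeal.pow_mem_of_mem hs 2 two_pos
    have hj2 : eta n a j ^ 2 ∈ q.asIdeal := q.asIdeal.pow_mem_of_mem ht 2 two_pos
    rcases lt_or_gt_of_ne hij with h | h
    · exact hmixed i ⟨(i, j), h⟩ hs (q.asIdeal.sub_mem hi2 hj2)
    · exact hmixed i ⟨(j, i), h⟩ hs (q.asIdeal.sub_mem hj2 hi2)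
  · exact hmixed i t hs ht
  · exact hmixed j s ht hs
  -- Since adj(VᵀV) = adj(V) adj(Vᵀ), the minors of T lie in q as soon as those of V do.
  · obtain ⟨T, hdet, hT⟩ := exists_matrix_discr (n := n) (a := a) ha
    rw [Delta, map_mul]
    refine Ideal.mul_mem_left _ _ ?_
    rw [← hdet]
    refine Matrix.algebraMap_det_mem_maximalIdeal_sq T p.asIdeal ?_ fun i j => ?_
    · rw [hdet]
      exact discr_mem_of_coincidence_mem ha q.asIdeal s hs
    · change algebraMap A (SSplit n a) _ ∈ q.asIdeal
      have h1 := (algebraMap A (SSplit n a)).map_adjugate T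
      rw [RingHom.mapMatrix_apply, RingHom.mapMatrix_apply, hT, Matrix.adjugate_mul_distrib] at h1
      rw [← Matrix.map_apply (f := algebraMap A (SSplit n a)), h1, Matrix.mul_apply]
      refine Ideal.sum_mem _ fun k _ => Ideal.mul_mem_right _ _ ?_
      exact Matrix.adjugate_vandermonde_mem _ _ s t (fun h => hst (congrArg _ h)) hs ht i k

end SignedSplit

/-! ### Local rings of B over height-one primes -/

theorem IsLocalRing.exists_maximalIdeal_eq_span_of_height_eq_one {R : Type*} [CommRing R]
    [IsNoetherianRing R] [IsLocalRing R] [IsDomain R] [IsIntegrallyClosed R]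
    (h : (IsLocalRing.maximalIdeal R).height = 1) :
    ∃ π, IsLocalRing.maximalIdeal R = Ideal.span {π} := by
  have h1 : IsIntegrallyClosed R ∧ ∀ P : Ideal R, P ≠ ⊥ → P.IsPrime →
      P = IsLocalRing.maximalIdeal R := by
    refine ⟨inferInstance, fun P hP hPp => ?_⟩
    by_contra hne
    have hlt := Ideal.height_strict_mono_of_isPrime_of_isPrime
      (lt_of_le_of_ne (IsLocalRing.le_maximalIdeal hPp.ne_top) hne)
    rw [h, Order.lt_one_iff, Ideal.height_eq_zero_iff_eq_bot] at hlt
    exact hP hlt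
  obtain ⟨⟨π, hπ⟩⟩ :=
    ((tfae_of_isNoetherianRing_of_isLocalRing_of_isDomain R).out 3 4 rfl rfl).1 h1
  exact ⟨π, hπ⟩

namespace SignedSplit

universe u

variable {A : Type u} [CommRing A] {n : ℕ} {a : ℕ → A}

/-- The maximal ideal of B_q is generated by one nonzerodivisor: a uniformizer of A_p if Δ ∉ p, and
the divisor t of Δ from `exists_formallyUnramified_quotient` if Δ ∈ p. -/
theorem isDomain_and_isIntegrallyClosed_localization [IsNoetherianRing A] (ha : a 0 = 1)
    (q : Ideal (SSplit n a)) [hq : q.IsPrime] (p : Ideal A) [hp : p.IsPrime] [hqp : q.LiesOver p]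
    [IsDomain (Localization.AtPrime p)] [IsIntegrallyClosed (Localization.AtPrime p)]
    (hheight : p.height = 1)
    (hΔ : algebraMap A (Localization.AtPrime p) (Delta n a) ∉
      IsLocalRing.maximalIdeal (Localization.AtPrime p) ^ 2)
    (hE : ∀ s t, s ≠ t → coincidence n a s ∈ q → coincidence n a t ∉ q) :
    IsDomain (Localization.AtPrime q) ∧ IsIntegrallyClosed (Localization.AtPrime q) := by
  have : Nontrivial (SSplit n a) := ⟨⟨0, 1, fun h => hq.one_notMem (h ▸ q.zero_mem)⟩⟩
  have : Nontrivial A := (algebraMap A (SSplit n a)).domain_nontrivial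
  obtain ⟨hfree, hfin, -⟩ := free_and_finite_and_nontrivial n a ha
  have : IsNoetherianRing (SSplit n a) := isNoetherian_of_tower A inferInstance
  have : IsNoetherianRing (Localization.AtPrime p) :=
    IsLocalization.isNoetherianRing p.primeCompl _ inferInstance
  have : IsNoetherianRing (Localization.AtPrime q) :=
    IsLocalization.isNoetherianRing q.primeCompl _ inferInstance
  have : Algebra.EssFiniteType A (Localization.AtPrime q) :=
    .comp A (SSplit n a) (Localization.AtPrime q)
  let : Algebra (Localization.AtPrime p) (Localization.AtPrime q) :=
    Localization.AtPrime.algebraOfLiesOver p q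
  have hmem : ∀ x, x ∈ p ↔ algebraMap A (SSplit n a) x ∈ q := fun x => by
    rw [hqp.over, Ideal.mem_comap]
  have hmax : ∀ x, algebraMap A (Localization.AtPrime p) x ∈
      IsLocalRing.maximalIdeal (Localization.AtPrime p) ↔ x ∈ p :=
    fun x => IsLocalization.AtPrime.to_map_mem_maximal_iff _ p x
  have hmaxq : ∀ x, algebraMap (SSplit n a) (Localization.AtPrime q) x ∈
      IsLocalRing.maximalIdeal (Localization.AtPrime q) ↔ x ∈ q :=
    fun x => IsLocalization.AtPrime.to_map_mem_maximal_iff _ q x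
  -- For n > 0 the factor 4 of Δ would put Δ into the square of the maximal ideal if 2 were in p.
  have h2 : 0 < n → (2 : SSplit n a) ∉ q := by
    intro hn h
    have h2p : (2 : A) ∈ p := (hmem 2).2 (by rwa [map_ofNat])
    refine hΔ ?_
    obtain ⟨m, rfl⟩ := Nat.exists_eq_succ_of_ne_zero hn.ne'
    have : Delta (m + 1) a =
        2 * 2 * (-((-4) ^ m * a (2 * (m + 1)) * (halfPoly (m + 1) a).discr)) := by
      rw [Delta]; ring
    rw [Nat.succ_eq_add_one, this, map_mul, map_mul, pow_two]
    exact Ideal.mul_mem_right _ _ (Ideal.mul_mem_mul ((hmax 2).2 h2p) ((hmax 2).2 h2p))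
  obtain ⟨π, hπ⟩ := IsLocalRing.exists_maximalIdeal_eq_span_of_height_eq_one
    (R := Localization.AtPrime p) (by
      rw [← hheight, ← IsLocalization.height_under p.primeCompl,
        IsLocalization.AtPrime.under_maximalIdeal (Localization.AtPrime p) p])
  have hπ0 : π ≠ 0 := by
    rintro rfl
    have h0 : p.height = 0 := by
      rw [← IsLocalization.AtPrime.under_maximalIdeal (Localization.AtPrime p) p,
        IsLocalization.height_under p.primeCompl, hπ, Ideal.height_eq_zero_iff_eq_bot]
      simp
    rw [h0] at hheight
    exact zero_ne_one hheight
  -- B_q is flat over the domain A_p.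
  have hregular : ∀ x : Localization.AtPrime p, x ≠ 0 →
      algebraMap _ (Localization.AtPrime q) x ∈ (Localization.AtPrime q)⁰ := by
    intro x hx
    have := Module.Flat.isSMulRegular_of_nonZeroDivisors (M := Localization.AtPrime q)
      (mem_nonZeroDivisors_of_ne_zero hx)
    rw [mem_nonZeroDivisors_iff_right]
    intro y hy
    exact this (by simpa [Algebra.smul_def, mul_comm] using hy)
  have hcomap : (IsLocalRing.maximalIdeal (Localization.AtPrime q)).comap
      (algebraMap A (Localization.AtPrime q)) = p := by
    ext x
    rw [Ideal.mem_comap, IsScalarTower.algebraMap_apply A (SSplit n a), hmaxq, hmem]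
  have hpmap : ∀ x, IsLocalRing.maximalIdeal (Localization.AtPrime p) = Ideal.span {x} →
      p.map (algebraMap A (Localization.AtPrime q)) =
        Ideal.span {algebraMap (Localization.AtPrime p) (Localization.AtPrime q) x} := by
    intro x hx
    rw [IsScalarTower.algebraMap_eq A (Localization.AtPrime p), ← Ideal.map_map,
      Localization.AtPrime.map_eq_maximalIdeal, hx, Ideal.map_span, Set.image_singleton]
  by_cases hΔp : Delta n a ∈ p
  · obtain ⟨t, htq, htΔ, hun⟩ :=
      exists_formallyUnramified_quotient ha q h2 hE ((hmem _).1 hΔp)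
    -- Δ lies in the maximal ideal but not in its square, so it is itself a uniformizer.
    have hspan : IsLocalRing.maximalIdeal (Localization.AtPrime p) =
        Ideal.span {algebraMap A (Localization.AtPrime p) (Delta n a)} := by
      have h1 := (hmax _).2 hΔp
      rw [hπ, Ideal.mem_span_singleton'] at h1
      obtain ⟨u, hu⟩ := h1
      have hunit : IsUnit u := by
        by_contra hcon
        have hu' : u ∈ IsLocalRing.maximalIdeal (Localization.AtPrime p) := hcon
        refine hΔ ?_
        rw [← hu, pow_two]
        exact Ideal.mul_mem_mul hu' (hπ ▸ Ideal.mem_span_singleton_self π)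
      rw [← hu, Ideal.span_singleton_mul_left_unit hunit, hπ]
    have hmaxt := Algebra.FormallyUnramified.maximalIdeal_eq_sup (A := A)
      (Ideal.span {algebraMap (SSplit n a) (Localization.AtPrime q) t})
      ((Ideal.span_singleton_le_iff_mem _).2 ((hmaxq t).2 htq))
    have hdvd := map_dvd (algebraMap (SSplit n a) (Localization.AtPrime q)) htΔ
    have htower : algebraMap (Localization.AtPrime p) (Localization.AtPrime q)
        (algebraMap A (Localization.AtPrime p) (Delta n a)) =
        algebraMap (SSplit n a) (Localization.AtPrime q)
          (algebraMap A (SSplit n a) (Delta n a)) := by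
      rw [← IsScalarTower.algebraMap_apply, ← IsScalarTower.algebraMap_apply]
    -- The maximal ideal is (Δ) + (t), and t ∣ Δ absorbs the first summand.
    rw [hcomap, hpmap _ hspan, sup_of_le_right (by
      rw [htower, Ideal.span_singleton_le_span_singleton]; exact hdvd)] at hmaxt
    refine IsLocalRing.isDomain_and_isIntegrallyClosed_of_maximalIdeal_eq_span ?_ hmaxt
    have hΔreg := hregular (algebraMap A (Localization.AtPrime p) (Delta n a))
      (fun h0 => hΔ (h0 ▸ Ideal.zero_mem _))
    rw [htower] at hΔreg
    obtain ⟨c, hc⟩ := hdvd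
    rw [hc] at hΔreg
    exact (mul_mem_nonZeroDivisors.1 hΔreg).1
  · have := formallyUnramified_localization ha q h2 (fun h => hΔp ((hmem _).2 h)) ⊥
    have hmaxt := Algebra.FormallyUnramified.maximalIdeal_eq_sup (A := A)
      (⊥ : Ideal (Localization.AtPrime q)) bot_le
    rw [hcomap, hpmap _ hπ, sup_bot_eq] at hmaxt
    exact IsLocalRing.isDomain_and_isIntegrallyClosed_of_maximalIdeal_eq_span
      (hregular π hπ0) hmaxt

end SignedSplit

/-! ### Globalization and the two criteria -/

theorem Localization.atPrime_isDomain_and_isIntegrallyClosed_iff {B : Type*} [CommRing B]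
    (M : Submonoid B) (Q : Ideal (Localization M)) [Q.IsPrime] :
    (IsDomain (Localization.AtPrime (Q.comap (algebraMap B (Localization M)))) ∧
      IsIntegrallyClosed (Localization.AtPrime (Q.comap (algebraMap B (Localization M))))) ↔
    (IsDomain (Localization.AtPrime Q) ∧ IsIntegrallyClosed (Localization.AtPrime Q)) := by
  let e := (IsLocalization.localizationLocalizationAtPrimeIsoLocalization M Q).toRingEquiv
  constructor
  · rintro ⟨h, h'⟩
    exact ⟨e.symm.toMulEquiv.isDomain _, IsIntegrallyClosed.of_equiv e⟩
  · rintro ⟨h, h'⟩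
    exact ⟨e.toMulEquiv.isDomain _, IsIntegrallyClosed.of_equiv e.symm⟩

namespace SignedSplit

universe u

variable {A : Type u} [CommRing A] {n : ℕ} {a : ℕ → A}

/-- An algebra in which `Δ` becomes invertible and which is a ring of fractions of the signed
splitting ring is unramified. -/
theorem formallyUnramified_of_isUnit_Delta (ha : a 0 = 1) {S : Type*} [CommRing S] [Algebra A S]
    (φ : SSplit n a →ₐ[A] S) (hφ : ∀ c, ∃ b u, IsUnit (φ u) ∧ φ u * c = φ b)
    (hΔ : IsUnit (algebraMap A S (Delta n a))) : Algebra.FormallyUnramified A S := by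
  have hdvd : ∀ b, b ∣ algebraMap A (SSplit n a) (Delta n a) → IsUnit (φ b) := by
    intro b hb
    refine isUnit_of_dvd_unit (map_dvd φ hb) ?_
    rwa [φ.commutes]
  refine formallyUnramified_of_D_eta_eq_zero φ hφ fun i => ?_
  refine derivation_eta_eq_zero_of_isUnit φ _ ?_ i (hdvd _ (eta_dvd_Delta ha i)) fun j hji => ?_
  · rw [← map_ofNat φ]
    refine hdvd _ ?_
    rw [algebraMap_Delta n a ha, mul_assoc]
    refine dvd_mul_of_dvd_left ?_ _
    exact (Dvd.intro 2 (by norm_num)).trans (dvd_pow_self 4 i.pos.ne')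
  · rw [← map_pow, ← map_pow, ← map_sub]
    rcases lt_or_gt_of_ne hji with h | h
    · rw [← neg_sub, map_neg]
      exact (hdvd _ (sub_dvd_Delta ha h)).neg
    · exact hdvd _ (sub_dvd_Delta ha h)

/-- The signed splitting ring of a noetherian normal ring is normal as soon as it is so in
codimension one. -/
theorem isNormalRing_of_forall_height_eq_one [IsNoetherianRing A] (ha : a 0 = 1)
    (hA : IsNormalRing A) (hΔ : Delta n a ∈ A⁰)
    (h : ∀ (q : Ideal (SSplit n a)) [q.IsPrime],
      (q.comap (algebraMap A (SSplit n a))).height = 1 →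
        IsDomain (Localization.AtPrime q) ∧ IsIntegrallyClosed (Localization.AtPrime q)) :
    IsNormalRing (SSplit n a) := by
  rintro ⟨q, hq⟩
  have : Nontrivial (SSplit n a) := ⟨⟨0, 1, fun h => hq.one_notMem (h ▸ q.zero_mem)⟩⟩
  have : Nontrivial A := (algebraMap A (SSplit n a)).domain_nontrivial
  obtain ⟨hfree, hfin, -⟩ := free_and_finite_and_nontrivial n a ha
  let p := q.comap (algebraMap A (SSplit n a))
  obtain ⟨hD, hIC⟩ := hA ⟨p, inferInstance⟩
  dsimp only at hD hIC
  -- A need not be a domain, so the codimension-one criterion is applied over A_p, to the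
  -- localization B₀ of B at the complement of p.
  let A₀ := Localization.AtPrime p
  let N := Algebra.algebraMapSubmonoid (SSplit n a) p.primeCompl
  let B₀ := Localization N
  have : IsNoetherianRing A₀ := IsLocalization.isNoetherianRing p.primeCompl _ inferInstance
  have : Module.Free A₀ B₀ := Module.free_of_isLocalizedModule p.primeCompl
    (IsScalarTower.toAlgHom A (SSplit n a) B₀).toLinearMap
  have : Module.Finite A₀ B₀ := Module.Finite.of_isLocalization A (SSplit n a) p.primeCompl
  let K := FractionRing A₀
  let F := Localization (Algebra.algebraMapSubmonoid B₀ A₀⁰)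
  have : Module.Finite K F := Module.Finite.of_isLocalization A₀ B₀ A₀⁰
  have : IsArtinianRing F := isArtinian_of_tower K inferInstance
  have : IsScalarTower A₀ K F := inferInstance
  have : IsScalarTower A K F := .of_algebraMap_eq fun x => by
    rw [IsScalarTower.algebraMap_apply A A₀ K, ← IsScalarTower.algebraMap_apply A₀ K F,
      IsScalarTower.algebraMap_apply A A₀ F]
  -- Δ stays a nonzerodivisor in A₀, so it is invertible in K. Hence F is unramified over the field
  -- K, and therefore reduced.
  have hunit : IsUnit (algebraMap A F (Delta n a)) := by
    rw [IsScalarTower.algebraMap_apply A K F, IsScalarTower.algebraMap_apply A A₀ K]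
    refine IsUnit.map _ (IsLocalization.map_units K (⟨_, ?_⟩ : A₀⁰))
    exact IsLocalization.map_nonZeroDivisors_le p.primeCompl A₀ ⟨_, hΔ, rfl⟩
  have hUn : Algebra.FormallyUnramified A F := by
    refine formallyUnramified_of_isUnit_Delta ha
      (IsScalarTower.toAlgHom A (SSplit n a) F) (fun c => ?_) hunit
    obtain ⟨⟨b₀, _, s, hs, rfl⟩, e1⟩ :=
      IsLocalization.surj (Algebra.algebraMapSubmonoid B₀ A₀⁰) c
    obtain ⟨⟨b, m⟩, e2⟩ := IsLocalization.surj N b₀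
    obtain ⟨⟨s₀, r⟩, e3⟩ := IsLocalization.surj p.primeCompl s
    have e2' := congrArg (algebraMap B₀ F) e2
    have e3' := congrArg (algebraMap A₀ F) e3
    have hm : IsUnit (algebraMap (SSplit n a) F m) := by
      rw [IsScalarTower.algebraMap_apply (SSplit n a) B₀ F]
      exact (IsLocalization.map_units B₀ m).map _
    have hr : IsUnit (algebraMap A F r) := by
      rw [IsScalarTower.algebraMap_apply A A₀ F]
      exact (IsLocalization.map_units A₀ r).map _
    have hs' : IsUnit (algebraMap A₀ F s) := by
      rw [IsScalarTower.algebraMap_apply A₀ B₀ F]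
      exact IsLocalization.map_units F
        (⟨_, s, hs, rfl⟩ : Algebra.algebraMapSubmonoid B₀ A₀⁰)
    dsimp only at e1
    simp only [map_mul, ← IsScalarTower.algebraMap_apply] at e1 e2' e3'
    refine ⟨r.1 • b, s₀ • m, ?_, ?_⟩
    · rw [map_smul, Algebra.smul_def, ← e3']
      exact (hs'.mul hr).mul hm
    · rw [map_smul, map_smul, Algebra.smul_def, Algebra.smul_def, ← e3']
      change algebraMap A₀ F s * algebraMap A F r * algebraMap (SSplit n a) F m * c =
        algebraMap A F r * algebraMap (SSplit n a) F b
      rw [← e2', ← e1]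
      ring
  have : Algebra.FormallyUnramified K F := .of_restrictScalars A K F
  have : IsReduced F := Algebra.FormallyUnramified.isReduced_of_field K F
  have : IsIntegrallyClosedIn B₀ F := isIntegrallyClosedIn_of_forall_height_eq_one (A := A₀)
    fun Q hQ hheight => by
      rw [← Localization.atPrime_isDomain_and_isIntegrallyClosed_iff]
      -- Heights are unchanged on contracting from A₀ to A, so the hypothesis applies to the
      -- contraction of Q to B.
      have e := IsLocalization.height_under p.primeCompl (A := A₀) (Q.comap (algebraMap A₀ B₀))
      rw [hheight, Ideal.under_def, Ideal.comap_comap, ← IsScalarTower.algebraMap_eq] at e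
      refine h _ ?_
      rwa [Ideal.comap_comap, ← IsScalarTower.algebraMap_eq]
  have hdisj : Disjoint (N : Set (SSplit n a)) q := by
    rw [Set.disjoint_left]
    rintro _ ⟨x, hx, rfl⟩ hxq
    exact hx hxq
  have hQp := IsLocalization.isPrime_of_isPrime_disjoint N B₀ q hq hdisj
  have hQ := IsLocalization.under_map_of_isPrime_disjoint N B₀ hq hdisj
  have hfinal := (Localization.atPrime_isDomain_and_isIntegrallyClosed_iff N
    (q.map (algebraMap (SSplit n a) B₀))).2
      (IsIntegrallyClosedIn.localization_atPrime (F := F) _)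
  have key : ∀ (q₁ : Ideal (SSplit n a)) [q₁.IsPrime], q₁ = q →
      (IsDomain (Localization.AtPrime q₁) ∧ IsIntegrallyClosed (Localization.AtPrime q₁)) →
        IsDomain (Localization.AtPrime q) ∧ IsIntegrallyClosed (Localization.AtPrime q) := by
    rintro _ _ rfl h₁
    exact h₁
  exact key _ hQ hfinal

theorem notMem_maximalIdeal_sq_of_primeOrder {p : PrimeSpectrum A} {x : A}
    (h : primeOrder p x = 0 ∨ primeOrder p x = 1) : p ∉ secondOrderLocus x := by
  intro hx
  have h2 : (2 : ℕ∞) ≤ primeOrder p x := le_iSup₂_of_le (f := fun (k : ℕ) _ => (k : ℕ∞)) 2 hx le_rfl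
  rcases h with h | h <;> rw [h] at h2 <;> exact absurd h2 (by decide)

theorem primeOrder_eq_zero_or_one {p : PrimeSpectrum A} {x : A} (h : p ∉ secondOrderLocus x) :
    primeOrder p x = 0 ∨ primeOrder p x = 1 := by
  have h1 : primeOrder p x ≤ 1 := by
    refine iSup₂_le fun k hk => ?_
    have : k ≤ 1 := by
      by_contra hlt
      exact h (Ideal.pow_le_pow_right (by omega : 2 ≤ k) hk)
    exact_mod_cast this
  rcases h1.lt_or_eq with h | h
  · exact Or.inl (Order.lt_one_iff.1 h)
  · exact Or.inr h

/-- A height-one prime cannot lie in E, so at most one coincidence occurs at each q above it;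
squarefreeness keeps Δ out of the square of the maximal ideal. -/
theorem isNormalRing_of_isSquarefreeElt [IsNoetherianRing A] (ha : a 0 = 1)
    (hA : IsNormalRing A) (hsq : IsSquarefreeElt (Delta n a)) (hΔ : Delta n a ∈ A⁰)
    (hE : CodimGE (lowerLocus n a) 2) : IsNormalRing (SSplit n a) := by
  refine isNormalRing_of_forall_height_eq_one ha hA hΔ fun q hq hheight => ?_
  let p : PrimeSpectrum A := PrimeSpectrum.comap (algebraMap A (SSplit n a)) ⟨q, hq⟩
  have hp : p.asIdeal.height = 1 := hheight
  have : q.LiesOver p.asIdeal := ⟨rfl⟩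
  obtain ⟨_, _⟩ := hA p
  refine isDomain_and_isIntegrallyClosed_localization ha q p.asIdeal hp
    (notMem_maximalIdeal_sq_of_primeOrder (hsq p hp)) fun s t hst hs ht => ?_
  have := hE p ⟨⟨q, hq⟩, ⟨s, t, hst, hs, ht⟩, rfl⟩
  rw [hp] at this
  exact absurd this (by decide)

theorem isSquarefreeElt_of_codimGE {x : A} (h : CodimGE (secondOrderLocus x) 2) :
    IsSquarefreeElt x := fun p hp => primeOrder_eq_zero_or_one fun hx => by
  have := h p hx
  rw [hp] at this
  exact absurd this (by decide)

end SignedSplit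

theorem mainTheorem4 {A : Type*} [CommRing A] [IsNoetherianRing A]
    (n : ℕ) (a : ℕ → A) (ha : a 0 = 1) :
    -- the criterion in terms of the coincidence locus
    (SignedSplit.IsNormalRing A →
      SignedSplit.IsSquarefreeElt (SignedSplit.Delta n a) →
      SignedSplit.Delta n a ∈ nonZeroDivisors A →
      SignedSplit.CodimGE (SignedSplit.lowerLocus n a) 2 →
        SignedSplit.IsNormalRing (SignedSplit.SSplit n a)) ∧
    -- the variant in terms of the second-order vanishing locus
    (SignedSplit.IsNormalRing A →
      SignedSplit.Delta n a ∈ nonZeroDivisors A →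
      SignedSplit.CodimGE (SignedSplit.secondOrderLocus (SignedSplit.Delta n a)) 2 →
        SignedSplit.IsSquarefreeElt (SignedSplit.Delta n a) ∧
        SignedSplit.IsNormalRing (SignedSplit.SSplit n a)) := by
  refine ⟨fun hA hsq hΔ hE => SignedSplit.isNormalRing_of_isSquarefreeElt ha hA hsq hΔ hE,
    fun hA hΔ hV => ?_⟩
  have hsq := SignedSplit.isSquarefreeElt_of_codimGE hV
  exact ⟨hsq, SignedSplit.isNormalRing_of_isSquarefreeElt ha hA hsq hΔ fun p hp =>
    hV p (SignedSplit.lowerLocus_subset_secondOrderLocus ha hp)⟩
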